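/- Let $\mathcal K$ be an augmented virtual double category in the sense of Koudenburg: it has objects, a category of vertical morphisms $f\colon A\to C$, horizontal morphisms $J\colon A ⇸ B$, and cells $\phi\colon \underline J\Rightarrow\underline K$ with a vertical source and a vertical target, whose horizontal source $\underline J=(J_1,\dots,J_n)$ is a (possibly empty) path and whose horizontal target $\underline K$ is a path of length $1$ (unary cell) or $0$ (nullary cell). Cells have associative and unital vertical composites $\psi\circ(\phi_1,\dots,\phi_n)$, with identity cells $\mathrm{id}_J$ and $\mathrm{id}_f$. Write $f\circ\eta=\mathrm{id}_f\circ\eta$ for nullary $\eta$, and $\phi\odot\psi=\mathrm{id}\circ(\phi,\psi)$ for the horizontal composite of a nullary cell $\phi$ followed by a cell $\psi$. **Definitions.** Throughout, "weak" notions are given in parentheses. * A cell $\psi\colon J\Rightarrow\underline K$ with vertical source $f$ and target $g$ is *cartesian* (defining $J$ as the restriction $\underline K(f,g)$) if every cell $\underline H\Rightarrow\underline K$ with vertical source $f\circ h$ and vertical target $g\circ k$ factors uniquely as $\psi\circ\phi$, with $\phi\colon\underline H\Rightarrow J$ having vertical source $h$ and target $k$. The companion of $f\colon A\to C$ is $f_*=C(f,\mathrm{id})$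 and its conjoint is $f^*=C(\mathrm{id},f)$. $\mathcal K$ *has all cartesian nullary cells* if every horizontal $J$ is the source of a cartesian nullary cell. * A nullary cell $\eta\colon\underline J\Rightarrow M$ with vertical source $d\colon A_0\to M$ and target $l\colon A_n\to M$ is *(weakly) left Kan* if every nullary cell $\underline J\frown\underline H\Rightarrow M$ with vertical source $d$, with $\underline H$ any path (in the weak case: empty), factors uniquely as $\eta\odot\phi'$. If $n\ge1$, it is *pointwise* (weakly) left Kan if moreover $\eta\circ(\mathrm{id}_{J_1},\dots,\mathrm{id}_{J_{n-1}},\mathrm{cart})$ is (weakly) left Kan for every cartesian cell $\mathrm{cart}$ defining a restriction $J_n(\mathrm{id},k)$ with $k\colon X\to A_n$. A morphism $f\colon M\to N$ *preserves* such a (pointwise) (weakly) left Kan cell $\eta$ if $f\circ\eta$ is again so, and $\eta$ is *absolutely* (pointwise) (weakly) left Kan if it is so and is preserved by every $f\colon M\to N$. * A path of cells $\underline\phi$ with vertical source $f_0$, vertical target $f_n$ and total horizontal target $\underline K$ is *weakly nullary-cocartesian* (resp. *weakly cocartesian*) if every nullary cell (resp. every cell) with the same horizontal source as $\underline\phi$,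 vertical source $h\circ f_0$ and vertical target $k\circ f_n$ factors uniquely as $\chi'\circ\underline\phi$, with $\chi'$ having horizontal source $\underline K$, vertical source $h$ and vertical target $k$. It is *right* (nullary-)cocartesian if moreover $\underline\phi\frown(\mathrm{cart},\mathrm{id}_{K_2},\dots,\mathrm{id}_{K_q})$ is weakly (nullary-)cocartesian for every non-empty path $(K_1,\dots,K_q)$ and every cartesian cell $\mathrm{cart}$ defining a restriction $K_1(f_n,\mathrm{id})$. * A right (resp. weakly) (nullary-)cocartesian cell $\phi\colon(J_1,\dots,J_n)\Rightarrow K$ with $n\ge1$ and trivial vertical target is *pointwise* so if, whenever $J_n(\mathrm{id},k)$ exists, $K(\mathrm{id},k)$ exists too and the cell $\phi''$ determined by $\phi\circ(\mathrm{id},\dots,\mathrm{id},\mathrm{cart})=\mathrm{cart}\circ\phi''$ is again right (resp. weakly) (nullary-)cocartesian. * A nullary cell $\eta$ as above satisfies the *(pointwise) (weak) left Beck–Chevalley condition* if the conjoint $l^*\colon M ⇸ A_n$ exists and the unique factorisation $\eta'\colon\underline J\Rightarrow l^*$ in $\eta=\mathrm{cart}\circ\eta'$ is (pointwise) right (resp.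 weakly) nullary-cocartesian. * $y\colon M\to\widehat M$ is a *(weak) Yoneda morphism* if every cartesian nullary cell $J\Rightarrow\widehat M$ with vertical source $y$ is (weakly) left Kan, and every $J\colon M ⇸ B$ admits a cartesian nullary cell $J\Rightarrow\widehat M$ with vertical source $y$ and some vertical target $B\to\widehat M$. **Theorem.** Let $\eta\colon\underline J\Rightarrow M$ be a nullary cell with $\underline J\colon A_0 ⇸ A_n$, vertical source $d\colon A_0\to M$ and vertical target $l\colon A_n\to M$. If the conjoint $l^*$ exists let $\eta'$ denote the factorisation $\eta=\mathrm{cart}\circ\eta'$. Consider the following conditions, in the ordinary case and in the weak case (respectively). 1. (a) For every $f\colon M\to N$, every path $\underline H$ starting at $A_n$ (in the weak case: $\underline H$ empty) and every path $\underline L$ of length at most $1$, any cell $\phi\colon\underline J\frown\underline H\Rightarrow\underline L$ with vertical source $f\circ d$ factors uniquely as $\phi=(f\circ\eta)\odot\phi'$. 2. (b) $\eta'$ is right (respectively weakly) cocartesian. 3. (c) $\eta$ satisfies the (weak) left Beck–Chevalley condition. 4. (d) $\eta$ is absolutely (weakly) left Kan. 5. (e) $\eta$ is (weakly) left Kan and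 preserved by $y$. 6. (f) The factorisation property of (a) holds for $f=\mathrm{id}_M$, that is through $\eta$. 7. (g) $\eta$ is (weakly) left Kan and preserved by every $g\colon M\to N$ whose companion $g_*$ exists. Then (a) $\Rightarrow$ (d). If $l^*$ exists then (a) $\Leftrightarrow$ (b) $\Rightarrow$ (c) $\Leftrightarrow$ (d); if moreover $\mathcal K$ has all cartesian nullary cells then (a)–(d) are equivalent. If a (weak) Yoneda morphism $y\colon M\to\widehat M$ exists then (a) $\Rightarrow$ (d) $\Rightarrow$ (e) $\Rightarrow$ (f) $\Rightarrow$ (g). If all companions exist in $\mathcal K$ then (g) $\Rightarrow$ (d). If $\underline J=(J_1,\dots,J_n)$ is non-empty and the conjoint $(l\circ k)^*$ exists for every $k\colon X\to A_n$, then the same implications, under the same additional hypotheses, hold for the pointwise (weak) variants of the conditions: in (b), (c), (d), (e), (g) the notions are replaced by their pointwise variants, and in (a) and (f) the unique factorisations are required through $f\circ\eta\circ(\mathrm{id}_{J_1},\dots,\mathrm{id}_{J_{n-1}},\mathrm{cart})$ (with $f=\mathrm{id}_M$ in (f)), for every $\mathrm{cart}$ defining a restriction of the form $J_n(\mathrm{id},k)$.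 -/

import Mathlib

open CategoryTheory

universe u v w t

set_option linter.checkUnivs false

/-! ### Paths of horizontal morphisms -/

/-- A (possibly empty) path `(J₁, …, Jₙ)` of horizontal morphisms from `A₀` to `Aₙ`;
`P.cons J` is the path `P` followed by `J`. -/
inductive HPath {𝒦 : Type u} (H : 𝒦 → 𝒦 → Type w) : 𝒦 → 𝒦 → Type (max u w)
  | nil {A : 𝒦} : HPath H A A
  | cons {A B C : 𝒦} (P : HPath H A B) (J : H B C) : HPath H A C

namespace HPath

variable {𝒦 : Type u} {H : 𝒦 → 𝒦 → Type w}

/-- The path consisting of one horizontal morphism. -/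
abbrev single {A B : 𝒦} (J : H A B) : HPath H A B := nil.cons J

/-- Concatenation of paths. -/
def comp {A B C : 𝒦} (P : HPath H A B) : HPath H B C → HPath H A C
  | nil => P
  | cons Q J => (P.comp Q).cons J

/-- The path is empty. -/
def IsEmpty {A B : 𝒦} : HPath H A B → Prop
  | nil => True
  | cons _ _ => False

@[simp] theorem comp_nil {A B : 𝒦} (P : HPath H A B) : P.comp nil = P := rfl

@[simp] theorem comp_cons {A B C D : 𝒦} (P : HPath H A B) (Q : HPath H B C) (J : H C D) :
    P.comp (Q.cons J) = (P.comp Q).cons J := rfl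

@[simp] theorem nil_comp {A B : 𝒦} (P : HPath H A B) : (nil : HPath H A A).comp P = P := by
  induction P with
  | nil => rfl
  | cons P J ih => simp [ih]

@[simp] theorem comp_assoc {A B C D : 𝒦} (P : HPath H A B) (Q : HPath H B C)
    (R : HPath H C D) : (P.comp Q).comp R = P.comp (Q.comp R) := by
  induction R with
  | nil => rfl
  | cons R J ih => simp [ih]

end HPath

/-- A path of horizontal morphisms of length at most one: these are the horizontal targets
of cells. -/
inductive ShortPath {𝒦 : Type u} (H : 𝒦 → 𝒦 → Type w) : 𝒦 → 𝒦 → Type (max u w)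
  | nil {A : 𝒦} : ShortPath H A A
  | single {A B : 𝒦} (J : H A B) : ShortPath H A B

/-- A path of length at most one, as a path. -/
abbrev ShortPath.toPath {𝒦 : Type u} {H : 𝒦 → 𝒦 → Type w} {A B : 𝒦} :
    ShortPath H A B → HPath H A B
  | .nil => .nil
  | .single J => .single J

/-! ### Augmented virtual graphs and paths of cells -/

/-- An augmented virtual graph: a category of objects and vertical morphisms, horizontal
morphisms, and cells `J ⇒ K` with vertical source `f` and vertical target `g`, whose horizontal
source `J` is any path and whose horizontal target `K` is a path of length at most one.
A cell is nullary if `K` is empty and unary otherwise. -/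
class AugmentedVirtualGraph (𝒦 : Type u) extends Category.{v} 𝒦 where
  /-- Horizontal morphisms. -/
  Hor : 𝒦 → 𝒦 → Type w
  /-- Cells with given horizontal source, vertical source, vertical target, horizontal target. -/
  Cell : ∀ {A B C D : 𝒦}, HPath Hor A B → (A ⟶ C) → (B ⟶ D) → ShortPath Hor C D → Type t

open AugmentedVirtualGraph

/-- A path `(φ₁, …, φₙ)` of horizontally composable cells, the vertical target of each `φᵢ` being
the vertical source of the next one, with its total horizontal source, vertical source, vertical
target and total horizontal target (the concatenations of those of the `φᵢ`). For `n = 0` it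
consists of a single vertical morphism. The last two arguments of `snoc` only serve to avoid
transport along equalities of paths. -/
inductive CellPath {𝒦 : Type u} [AugmentedVirtualGraph.{u, v, w, t} 𝒦] :
    ∀ {A B C D : 𝒦}, HPath (Hor (𝒦 := 𝒦)) A B → (A ⟶ C) → (B ⟶ D) →
      HPath (Hor (𝒦 := 𝒦)) C D → Type (max u v w t)
  | nil {A C : 𝒦} (f : A ⟶ C) : CellPath .nil f f .nil
  | snoc {A B C D B' D' : 𝒦} {J : HPath Hor A B} {f : A ⟶ C} {g : B ⟶ D} {K : HPath Hor C D}
      {J' : HPath Hor B B'} {h : B' ⟶ D'} {K' : ShortPath Hor D D'}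
      {J'' : HPath Hor A B'} {K'' : HPath Hor C D'}
      (Φ : CellPath J f g K) (φ : Cell J' g h K')
      (hJ : J'' = J.comp J') (hK : K'' = K.comp K'.toPath) : CellPath J'' f h K''

namespace CellPath

variable {𝒦 : Type u} [AugmentedVirtualGraph.{u, v, w, t} 𝒦]

/-- The path `(φ)` consisting of one cell. -/
def single {A B C D : 𝒦} {J : HPath Hor A B} {f : A ⟶ C} {g : B ⟶ D} {K : ShortPath Hor C D}
    (φ : Cell J f g K) : CellPath J f g K.toPath :=
  snoc (nil f) φ (by simp) (by simp)

/-- Concatenation of paths of cells. -/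
def append {A B C D B' D' : 𝒦} {J : HPath Hor A B} {f : A ⟶ C} {g : B ⟶ D}
    {K : HPath Hor C D} {J' : HPath Hor B B'} {h : B' ⟶ D'} {K' : HPath Hor D D'}
    (Φ : CellPath J f g K) (Ψ : CellPath J' g h K') :
    CellPath (J.comp J') f h (K.comp K') :=
  match Ψ with
  | nil _ => Φ
  | snoc Ψ ψ hJ hK => snoc (append Φ Ψ) ψ (by simp [hJ]) (by simp [hK])

end CellPath

/-! ### Augmented virtual double categories -/

/-- The data of an augmented virtual double category: vertical composites `ψ ∘ (φ₁, …, φₙ)`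
and identity cells. The equations `hf`, `hg` say that the vertical source and target of the
composite are the composites of those of `φ₁`, `ψ` and of `φₙ`, `ψ`. -/
class AugmentedVirtualDoubleData (𝒦 : Type u) extends AugmentedVirtualGraph.{u, v, w, t} 𝒦 where
  /-- The vertical composite `ψ ∘ (φ₁, …, φₙ)`. -/
  vcomp : ∀ {A B C D E F : 𝒦} {J : HPath Hor A B} {f : A ⟶ C} {g : B ⟶ D} {K : HPath Hor C D}
    {h : C ⟶ E} {k : D ⟶ F} {L : ShortPath Hor E F} {f' : A ⟶ E} {g' : B ⟶ F},
    CellPath J f g K → Cell K h k L → (hf : f' = f ≫ h) → (hg : g' = g ≫ k) → Cell J f' g' L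
  /-- The horizontal identity cell `id_J`. -/
  idHor : ∀ {A B : 𝒦} (J : Hor A B), Cell (.single J) (𝟙 A) (𝟙 B) (.single J)
  /-- The vertical identity cell `id_f`. -/
  idVer : ∀ {A C : 𝒦} (f : A ⟶ C), Cell .nil f f .nil

open AugmentedVirtualDoubleData

section

variable {𝒦 : Type u} [AugmentedVirtualDoubleData.{u, v, w, t} 𝒦]

/-- The identity cell of a path of length at most one. -/
def idCell {A B : 𝒦} : (K : ShortPath Hor A B) → Cell K.toPath (𝟙 A) (𝟙 B) K
  | .nil => idVer (𝟙 _)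
  | .single J => idHor J

/-- The path `(id_{J₁}, …, id_{Jₙ})` of identity cells. -/
def idPath {A B : 𝒦} : (J : HPath Hor A B) → CellPath J (𝟙 A) (𝟙 B) J
  | .nil => .nil (𝟙 _)
  | .cons P J => .snoc (idPath P) (idHor J) rfl rfl

/-- A path of cells `ψⱼ` together with, for each `j`, a path `Φⱼ` of cells whose total horizontal
target is the horizontal source of `ψⱼ`, such that the `Φⱼ` are composable too. -/
inductive CellGrid : ∀ {A B C D E F : 𝒦}, HPath (Hor (𝒦 := 𝒦)) A B → (A ⟶ C) → (B ⟶ D) →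
    HPath (Hor (𝒦 := 𝒦)) C D → (C ⟶ E) → (D ⟶ F) → HPath (Hor (𝒦 := 𝒦)) E F →
      Type (max u v w t)
  | nil {A C E : 𝒦} (f : A ⟶ C) (h : C ⟶ E) : CellGrid .nil f f .nil h h .nil
  | snoc {A B C D E F B' D' F' : 𝒦} {J : HPath Hor A B} {f : A ⟶ C} {g : B ⟶ D}
      {K : HPath Hor C D} {h : C ⟶ E} {k : D ⟶ F} {L : HPath Hor E F}
      {J' : HPath Hor B B'} {g' : B' ⟶ D'} {K' : HPath Hor D D'} {k' : D' ⟶ F'}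
      {L' : ShortPath Hor F F'} (S : CellGrid J f g K h k L)
      (Φ : CellPath J' g g' K') (ψ : Cell K' k k' L') :
      CellGrid (J.comp J') f g' (K.comp K') h k' (L.comp L'.toPath)

namespace CellGrid

/-- The concatenation of the paths `Φⱼ`. -/
def top {A B C D E F : 𝒦} {J : HPath Hor A B} {f : A ⟶ C} {g : B ⟶ D} {K : HPath Hor C D}
    {h : C ⟶ E} {k : D ⟶ F} {L : HPath Hor E F} : CellGrid J f g K h k L → CellPath J f g K
  | nil f _ => .nil f
  | snoc S Φ _ => S.top.append Φ

/-- The path of the cells `ψⱼ`. -/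
def bottom {A B C D E F : 𝒦} {J : HPath Hor A B} {f : A ⟶ C} {g : B ⟶ D} {K : HPath Hor C D}
    {h : C ⟶ E} {k : D ⟶ F} {L : HPath Hor E F} : CellGrid J f g K h k L → CellPath K h k L
  | nil _ h => .nil h
  | snoc S _ ψ => .snoc S.bottom ψ rfl rfl

/-- The path of the composites `ψⱼ ∘ Φⱼ`. -/
def composite {A B C D E F : 𝒦} {J : HPath Hor A B} {f : A ⟶ C} {g : B ⟶ D} {K : HPath Hor C D}
    {h : C ⟶ E} {k : D ⟶ F} {L : HPath Hor E F} :
    CellGrid J f g K h k L → CellPath J (f ≫ h) (g ≫ k) L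
  | nil f h => .nil (f ≫ h)
  | snoc S Φ ψ => .snoc S.composite (vcomp Φ ψ rfl rfl) rfl rfl

end CellGrid

end

/-- An augmented virtual double category: vertical composition of cells is associative and
unital. By `vcomp_idVer` vertical identity cells can be left out of a path of cells; for empty
`Φ` and `Ψ` this axiom says that composing with the empty path of cells at `g` is by definition
composing with the vertical identity cell `id_g`. -/
class AugmentedVirtualDoubleCategory (𝒦 : Type u) extends
    AugmentedVirtualDoubleData.{u, v, w, t} 𝒦 where
  /-- `χ ∘ (ψ₁ ∘ Φ₁, …, ψₙ ∘ Φₙ) = (χ ∘ (ψ₁, …, ψₙ)) ∘ (Φ₁ ⌢ ⋯ ⌢ Φₙ)`. -/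
  vcomp_assoc : ∀ {A B C D E F X Y : 𝒦} {J : HPath Hor A B} {f : A ⟶ C} {g : B ⟶ D}
    {K : HPath Hor C D} {h : C ⟶ E} {k : D ⟶ F} {L : HPath Hor E F}
    (S : CellGrid J f g K h k L) {p : E ⟶ X} {q : F ⟶ Y} {N : ShortPath Hor X Y}
    (χ : Cell L p q N),
    vcomp S.composite χ (f' := f ≫ h ≫ p) (g' := g ≫ k ≫ q)
        (Category.assoc _ _ _).symm (Category.assoc _ _ _).symm =
      vcomp S.top (vcomp S.bottom χ rfl rfl) rfl rfl
  /-- `id_K ∘ φ = φ`. -/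
  vcomp_idCell : ∀ {A B C D : 𝒦} {J : HPath Hor A B} {f : A ⟶ C} {g : B ⟶ D}
    {K : ShortPath Hor C D} (φ : Cell J f g K),
    vcomp (.single φ) (idCell K) (Category.comp_id f).symm (Category.comp_id g).symm = φ
  /-- `ψ ∘ (id_{J₁}, …, id_{Jₙ}) = ψ`. -/
  idPath_vcomp : ∀ {A B C D : 𝒦} {J : HPath Hor A B} {f : A ⟶ C} {g : B ⟶ D}
    {K : ShortPath Hor C D} (ψ : Cell J f g K),
    vcomp (idPath J) ψ (Category.id_comp f).symm (Category.id_comp g).symm = ψ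
  /-- `ψ ∘ (φ₁, …, φᵢ, id_g, φᵢ₊₁, …, φₙ) = ψ ∘ (φ₁, …, φₙ)`. -/
  vcomp_idVer : ∀ {A B C D B' D' E F : 𝒦} {J : HPath Hor A B} {f : A ⟶ C} {g : B ⟶ D}
    {K : HPath Hor C D} {J' : HPath Hor B B'} {g' : B' ⟶ D'} {K' : HPath Hor D D'}
    (Φ : CellPath J f g K) (Ψ : CellPath J' g g' K')
    {h : C ⟶ E} {k : D' ⟶ F} {L : ShortPath Hor E F} (ψ : Cell (K.comp K') h k L),
    vcomp (CellPath.append (.snoc Φ (idVer g) rfl rfl) Ψ) ψ rfl rfl =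
      vcomp (Φ.append Ψ) ψ rfl rfl

namespace AugmentedVirtualDoubleCategory

variable {𝒦 : Type u} [AugmentedVirtualDoubleCategory.{u, v, w, t} 𝒦]

/-! ### Composites -/

/-- The horizontal composite `φ ⊙ ψ = id_L ∘ (φ, ψ)` of a nullary cell `φ` and a cell `ψ`. -/
def hcomp {A B B' C D : 𝒦} {J : HPath Hor A B} {H : HPath Hor B B'} {f : A ⟶ C} {g : B ⟶ C}
    {h : B' ⟶ D} {L : ShortPath Hor C D} (φ : Cell J f g .nil) (ψ : Cell H g h L) :
    Cell (J.comp H) f h L :=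
  vcomp (.snoc (.single φ) ψ rfl (HPath.nil_comp _).symm) (idCell L) (by simp) (by simp)

/-- The composite `f ∘ η` of a nullary cell `η : J ⇒ M` and a morphism `f : M ⟶ N`, that is
`id_f ∘ η`. -/
def postcomp {A B M N : 𝒦} {J : HPath Hor A B} {d : A ⟶ M} {l : B ⟶ M}
    (η : Cell J d l .nil) (f : M ⟶ N) : Cell J (d ≫ f) (l ≫ f) .nil :=
  vcomp (.single η) (idVer f) rfl rfl

/-- The composite `φ ∘ (id_{J₁}, …, id_{Jₙ₋₁}, c)`, with `φ : (J₁, …, Jₙ) ⇒ K` and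
`c : R ⇒ Jₙ` with trivial vertical source. -/
def precompLast {A A' B C D Y : 𝒦} {P : HPath Hor A A'} {J : Hor A' B} {f : A ⟶ C} {g : B ⟶ D}
    {K : ShortPath Hor C D} (φ : Cell (P.cons J) f g K) {k : Y ⟶ B} {R : Hor A' Y}
    (c : Cell (.single R) (𝟙 A') k (.single J)) {g' : Y ⟶ D} (hg : g' = k ≫ g) :
    Cell (P.cons R) f g' K :=
  vcomp (.snoc (idPath P) c rfl rfl) φ (by simp) hg

/-! ### Cartesian cells -/

/-- The cell `ψ : J ⇒ K`, with vertical source `f` and target `g`, is cartesian, that is it defines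
`J` as the restriction `K(f, g)`. -/
def IsCartesian {A B C D : 𝒦} {J : Hor A B} {f : A ⟶ C} {g : B ⟶ D} {K : ShortPath Hor C D}
    (ψ : Cell (.single J) f g K) : Prop :=
  ∀ ⦃X Y : 𝒦⦄ (H : HPath Hor X Y) (h : X ⟶ A) (k : Y ⟶ B) (χ : Cell H (h ≫ f) (k ≫ g) K),
    ∃! φ : Cell H h k (.single J), vcomp (.single φ) ψ rfl rfl = χ

/-- The companion `f_* = C(f, id)` of `f : A ⟶ C` exists. -/
def HasCompanion {A C : 𝒦} (f : A ⟶ C) : Prop :=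
  ∃ (S : Hor A C) (c : Cell (.single S) f (𝟙 C) .nil), IsCartesian c

/-- The conjoint `f^* = C(id, f)` of `f : A ⟶ C` exists. -/
def HasConjoint {A C : 𝒦} (f : A ⟶ C) : Prop :=
  ∃ (S : Hor C A) (c : Cell (.single S) (𝟙 C) f .nil), IsCartesian c

variable (𝒦) in
/-- All companions exist. -/
def HasCompanions : Prop := ∀ ⦃A C : 𝒦⦄ (f : A ⟶ C), HasCompanion f

variable (𝒦) in
/-- Every horizontal morphism admits a cartesian nullary cell. -/
def HasCartesianNullaryCells : Prop :=
  ∀ ⦃A B : 𝒦⦄ (J : Hor A B),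
    ∃ (C : 𝒦) (f : A ⟶ C) (g : B ⟶ C) (ψ : Cell (.single J) f g .nil), IsCartesian ψ

/-! ### Left Kan cells -/

/-- The two parallel variants of the notions below. -/
inductive Variant
  | ordinary
  | weak

/-- The paths `H` that occur in the universal property of left Kan cells: all paths in the
ordinary case, only the empty ones in the weak case. -/
def Variant.Allows (s : Variant) {A B : 𝒦} (H : HPath (Hor (𝒦 := 𝒦)) A B) : Prop :=
  match s with
  | .ordinary => True
  | .weak => H.IsEmpty

/-- The nullary cell `η : J ⇒ M` is left Kan (respectively weakly left Kan): any nullary cell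
`φ : J ⌢ H ⇒ M` (with `H` empty in the weak case) factors uniquely as `φ = η ⊙ φ'`. -/
def IsLeftKan (s : Variant) {A B M : 𝒦} {J : HPath Hor A B} {d : A ⟶ M} {l : B ⟶ M}
    (η : Cell J d l .nil) : Prop :=
  ∀ ⦃B' : 𝒦⦄ (H : HPath Hor B B') (k : B' ⟶ M) (φ : Cell (J.comp H) d k .nil), s.Allows H →
    ∃! φ' : Cell H l k .nil, hcomp η φ' = φ

/-- `η : (J₁, …, Jₙ) ⇒ M`, with `n ≥ 1`, is pointwise (weakly) left Kan: it is (weakly) left Kan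
and so is its composite with any cartesian cell defining a restriction `Jₙ(id, k)`. -/
def IsPointwiseLeftKan (s : Variant) {A A' B M : 𝒦} {P : HPath Hor A A'} {J : Hor A' B}
    {d : A ⟶ M} {l : B ⟶ M} (η : Cell (P.cons J) d l .nil) : Prop :=
  IsLeftKan s η ∧
    ∀ ⦃Y : 𝒦⦄ (k : Y ⟶ B) (R : Hor A' Y) (c : Cell (.single R) (𝟙 A') k (.single J)),
      IsCartesian c → IsLeftKan s (precompLast η c rfl)

/-- `η` is absolutely (weakly) left Kan: it is (weakly) left Kan and preserved by all morphisms. -/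
def IsAbsolutelyLeftKan (s : Variant) {A B M : 𝒦} {J : HPath Hor A B} {d : A ⟶ M} {l : B ⟶ M}
    (η : Cell J d l .nil) : Prop :=
  IsLeftKan s η ∧ ∀ ⦃N : 𝒦⦄ (f : M ⟶ N), IsLeftKan s (postcomp η f)

/-- `η` is absolutely pointwise (weakly) left Kan. -/
def IsAbsolutelyPointwiseLeftKan (s : Variant) {A A' B M : 𝒦} {P : HPath Hor A A'} {J : Hor A' B}
    {d : A ⟶ M} {l : B ⟶ M} (η : Cell (P.cons J) d l .nil) : Prop :=
  IsPointwiseLeftKan s η ∧ ∀ ⦃N : 𝒦⦄ (f : M ⟶ N), IsPointwiseLeftKan s (postcomp η f)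

/-! ### Cocartesian paths -/

/-- The horizontal targets allowed in the universal property of cocartesian paths:
`nullary` for nullary-cocartesian, `unary` for unary-cocartesian, `all` for cocartesian (that is
both nullary- and unary-cocartesian). -/
inductive Targets
  | nullary
  | unary
  | all

/-- The horizontal target `L` is allowed. -/
def Targets.Allows (r : Targets) {C D : 𝒦} (L : ShortPath (Hor (𝒦 := 𝒦)) C D) : Prop :=
  match r, L with
  | .nullary, .nil => True
  | .nullary, .single _ => False
  | .unary, .nil => False
  | .unary, .single _ => True
  | .all, _ => True

/-- The path `Φ` of cells is weakly (nullary-, unary-)cocartesian. -/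
def IsWeaklyCocartesian (r : Targets) {A B C D : 𝒦} {J : HPath Hor A B} {f : A ⟶ C} {g : B ⟶ D}
    {K : HPath Hor C D} (Φ : CellPath J f g K) : Prop :=
  ∀ ⦃E F : 𝒦⦄ (L : ShortPath Hor E F) (h : C ⟶ E) (k : D ⟶ F)
    (χ : Cell J (f ≫ h) (g ≫ k) L), r.Allows L →
    ∃! χ' : Cell K h k L, vcomp Φ χ' rfl rfl = χ

/-- The path `Φ` of cells, with vertical target `g`, is right (nullary-, unary-)cocartesian: it is
weakly so and, for any non-empty path `(K₁, …, K_q)` such that the restriction `K₁(g, id)` exists,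
the path `Φ ⌢ (cart, id_{K₂}, …, id_{K_q})` is weakly so too. -/
def IsRightCocartesian (r : Targets) {A B C D : 𝒦} {J : HPath Hor A B} {f : A ⟶ C} {g : B ⟶ D}
    {K : HPath Hor C D} (Φ : CellPath J f g K) : Prop :=
  IsWeaklyCocartesian r Φ ∧
    ∀ ⦃Y Y' : 𝒦⦄ (K₁ : Hor D Y) (R : Hor B Y) (c : Cell (.single R) g (𝟙 Y) (.single K₁))
      (T : HPath Hor Y Y'), IsCartesian c →
      IsWeaklyCocartesian r (CellPath.append (.snoc Φ c rfl rfl) (idPath T))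

/-- The cell `φ` is right (respectively weakly) (nullary-, unary-)cocartesian. -/
def IsCocartesian (s : Variant) (r : Targets) {A B C D : 𝒦} {J : HPath Hor A B} {f : A ⟶ C}
    {g : B ⟶ D} {K : ShortPath Hor C D} (φ : Cell J f g K) : Prop :=
  match s with
  | .ordinary => IsRightCocartesian r (.single φ)
  | .weak => IsWeaklyCocartesian r (.single φ)

/-- The cell `φ : (J₁, …, Jₙ) ⇒ K`, with `n ≥ 1` and trivial vertical target, is pointwise right
(respectively weakly) (nullary-, unary-)cocartesian: it is right (weakly) cocartesian and, for any
restriction `Jₙ(id, k)`, the restriction `K(id, k)` exists and the factorisation `φ'` in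
`φ ∘ (id, …, id, cart) = cart ∘ φ'` is again right (weakly) cocartesian. -/
def IsPointwiseCocartesian (s : Variant) (r : Targets) {A A' B C : 𝒦} {P : HPath Hor A A'}
    {J : Hor A' B} {f : A ⟶ C} {K : Hor C B} (φ : Cell (P.cons J) f (𝟙 B) (.single K)) : Prop :=
  IsCocartesian s r φ ∧
    ∀ ⦃Y : 𝒦⦄ (k : Y ⟶ B) (R : Hor A' Y) (c : Cell (.single R) (𝟙 A') k (.single J)),
      IsCartesian c →
      ∃ (S : Hor C Y) (c' : Cell (.single S) (𝟙 C) k (.single K))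
        (φ' : Cell (P.cons R) f (𝟙 Y) (.single S)),
        IsCartesian c' ∧
        vcomp (.single φ') c' (f' := f) (g' := k) (by simp) (by simp) =
          precompLast φ c (by simp) ∧
        IsCocartesian s r φ'

/-! ### The left Beck-Chevalley condition -/

/-- The cell `φ : J ⇒ K`, with vertical target `g`, satisfies the (weak) left Beck-Chevalley
condition: the restriction `K(id, g)` (for empty `K`: the conjoint of `g`) exists and the
factorisation `φ'` in `φ = cart ∘ φ'` is right (respectively weakly) nullary-cocartesian. -/
def LeftBeckChevalley (s : Variant) {A B C D : 𝒦} {J : HPath Hor A B} {f : A ⟶ C} {g : B ⟶ D}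
    {K : ShortPath Hor C D} (φ : Cell J f g K) : Prop :=
  ∃ (S : Hor C B) (c : Cell (.single S) (𝟙 C) g K) (φ' : Cell J f (𝟙 B) (.single S)),
    IsCartesian c ∧ vcomp (.single φ') c (by simp) (by simp) = φ ∧ IsCocartesian s .nullary φ'

/-- The pointwise (weak) left Beck-Chevalley condition. -/
def PointwiseLeftBeckChevalley (s : Variant) {A A' B C D : 𝒦} {P : HPath Hor A A'}
    {J : Hor A' B} {f : A ⟶ C} {g : B ⟶ D} {K : ShortPath Hor C D}
    (φ : Cell (P.cons J) f g K) : Prop :=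
  ∃ (S : Hor C B) (c : Cell (.single S) (𝟙 C) g K)
    (φ' : Cell (P.cons J) f (𝟙 B) (.single S)),
    IsCartesian c ∧ vcomp (.single φ') c (by simp) (by simp) = φ ∧
      IsPointwiseCocartesian s .nullary φ'

/-! ### Yoneda morphisms -/

/-- The morphism `f` is dense (respectively weakly dense). -/
def IsDense (s : Variant) {A M : 𝒦} (f : A ⟶ M) : Prop :=
  ∀ ⦃B : 𝒦⦄ (J : Hor A B) (l : B ⟶ M) (η : Cell (.single J) f l .nil),
    IsCartesian η → IsLeftKan s η

/-- The morphism `y` is a Yoneda morphism (respectively a weak Yoneda morphism). -/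
def IsYoneda (s : Variant) {A A' : 𝒦} (y : A ⟶ A') : Prop :=
  IsDense s y ∧ ∀ ⦃B : 𝒦⦄ (J : Hor A B),
    ∃ (j : B ⟶ A') (ψ : Cell (.single J) y j .nil), IsCartesian ψ

/-! ### Unique factorisation of cells with arbitrary horizontal target -/

/-- For every `f : M ⟶ N`, any cell `φ : J ⌢ H ⇒ L` with vertical source `f ∘ d` and any horizontal
target `L` (with `H` empty in the weak case) factors uniquely as `φ = (f ∘ η) ⊙ φ'`. -/
def FactorsAfterAll (s : Variant) {A B M : 𝒦} {J : HPath Hor A B} {d : A ⟶ M} {l : B ⟶ M}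
    (η : Cell J d l .nil) : Prop :=
  ∀ ⦃N B' K : 𝒦⦄ (f : M ⟶ N) (H : HPath Hor B B') (L : ShortPath Hor N K) (h : B' ⟶ K)
    (φ : Cell (J.comp H) (d ≫ f) h L), s.Allows H →
    ∃! φ' : Cell H (l ≫ f) h L, hcomp (postcomp η f) φ' = φ

/-- The previous condition with `f = id_M` only. -/
def Factors (s : Variant) {A B M : 𝒦} {J : HPath Hor A B} {d : A ⟶ M} {l : B ⟶ M}
    (η : Cell J d l .nil) : Prop :=
  ∀ ⦃B' K : 𝒦⦄ (H : HPath Hor B B') (L : ShortPath Hor M K) (h : B' ⟶ K)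
    (φ : Cell (J.comp H) d h L), s.Allows H →
    ∃! φ' : Cell H l h L, hcomp η φ' = φ

/-- Pointwise variant of `FactorsAfterAll`: the factorisations are through the composites
`f ∘ η ∘ (id, …, id, cart)`, with `cart` defining any restriction `Jₙ(id, k)`. -/
def PointwiseFactorsAfterAll (s : Variant) {A A' B M : 𝒦} {P : HPath Hor A A'} {J : Hor A' B}
    {d : A ⟶ M} {l : B ⟶ M} (η : Cell (P.cons J) d l .nil) : Prop :=
  ∀ ⦃Y : 𝒦⦄ (k : Y ⟶ B) (R : Hor A' Y) (c : Cell (.single R) (𝟙 A') k (.single J)),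
    IsCartesian c → FactorsAfterAll s (precompLast η c rfl)

/-- Pointwise variant of `Factors`. -/
def PointwiseFactors (s : Variant) {A A' B M : 𝒦} {P : HPath Hor A A'} {J : Hor A' B}
    {d : A ⟶ M} {l : B ⟶ M} (η : Cell (P.cons J) d l .nil) : Prop :=
  ∀ ⦃Y : 𝒦⦄ (k : Y ⟶ B) (R : Hor A' Y) (c : Cell (.single R) (𝟙 A') k (.single J)),
    IsCartesian c → Factors s (precompLast η c rfl)

end AugmentedVirtualDoubleCategory

open AugmentedVirtualDoubleCategory

/-! Every condition is a statement about one family of maps: `φ ↦ ζ ⊙ φ`, from cells `H ⇒ L` to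
cells `J ⌢ H ⇒ L`, where `ζ` is `f ∘ η` or its composite with a restriction. The conditions differ
only in which `f`, `H` and `L` this map must be bijective for (`FactorsAt`, `FactorsTo`). Two
commuting squares with bijective sides compare them.

Changing the target: composition with a cartesian cell `ψ : L ⇒ K` with vertical source `p` is a
bijection on cells, and `ψ ∘ (η ⊙ φ) = (p ∘ η) ⊙ (ψ ∘ φ)`. So factoring cells with target `L`
through `η` is the same as factoring cells with target `K` through `p ∘ η`
(`IsCartesian.factorsAt_iff`). For nullary `ψ` with vertical source `y` this gives (e) ⇒ (f); for
the cartesian cell of a companion `g_*` it gives (f) ⇒ (g); for arbitrary cartesian nullary cells it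
gives (d) ⇒ (a).

Changing the source: if `S` is the conjoint of `l`, the conjoint identities show that `φ ↦ (f ∘
cart) ⊙ φ` is a bijection from cells out of `H` to cells out of `S ⌢ H`
(`IsCartesian.hcomp_bijective`). Precomposing with `η'` turns `(f ∘ cart) ⊙ φ` into `(f ∘ η) ⊙ φ`.
Hence cocartesianness of `η'` is the factorisation property of all the `f ∘ η`
(`isCocartesian_iff`): with all targets this is (a) ⇔ (b), with nullary targets (c) ⇔ (d).

The pointwise variants apply this to each `η ∘ (id, …, id, cart)`. Pasting of cartesian cells
identifies the restriction `l^*(id, k)` with the conjoint of `l ∘ k`, and `k = id` recovers the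
unrestricted condition. -/

namespace HPath

variable {𝒦 : Type u} {H : 𝒦 → 𝒦 → Type w}

/-- A non-empty path has a first horizontal morphism. -/
theorem exists_cons_eq_single_comp {A B C : 𝒦} (P : HPath H A B) (J : H B C) :
    ∃ (Y : 𝒦) (K : H A Y) (T : HPath H Y C), P.cons J = (single K).comp T := by
  induction P generalizing C with
  | nil => exact ⟨_, J, nil, rfl⟩
  | cons P J' ih =>
    obtain ⟨Y, K, T, h⟩ := ih J'
    exact ⟨Y, K, T.cons J, by rw [h]; rfl⟩

/-- Paths are built by adding a morphism at the end, whereas right cocartesianness singles out the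
first morphism of a path; this case distinction bridges the two. -/
theorem front_cases {A : 𝒦} {motive : ∀ {B : 𝒦}, HPath H A B → Prop} (nil : motive nil)
    (single_comp : ∀ {Y B : 𝒦} (K : H A Y) (T : HPath H Y B), motive ((single K).comp T))
    {B : 𝒦} (P : HPath H A B) : motive P := by
  cases P with
  | nil => exact nil
  | cons P J =>
    obtain ⟨Y, K, T, h⟩ := exists_cons_eq_single_comp P J
    rw [h]
    exact single_comp K T

end HPath

/-! ### Concatenation of paths of cells -/

namespace CellPath

variable {𝒦 : Type u} [AugmentedVirtualGraph.{u, v, w, t} 𝒦]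

/-- Unit and associativity laws for concatenating horizontal paths hold only propositionally, so
equations between paths of cells are heterogeneous; this congruence is what their inductions run on.
-/
theorem snoc_heq {A B C D B' D' : 𝒦} {J₁ J₂ : HPath Hor A B} {f₁ f₂ : A ⟶ C} {g₁ g₂ : B ⟶ D}
    {K₁ K₂ : HPath Hor C D} {J' : HPath Hor B B'} {h₁ h₂ : B' ⟶ D'} {K' : ShortPath Hor D D'}
    {J₁' J₂' : HPath Hor A B'} {K₁' K₂' : HPath Hor C D'}
    {Φ₁ : CellPath J₁ f₁ g₁ K₁} {Φ₂ : CellPath J₂ f₂ g₂ K₂}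
    {φ₁ : Cell J' g₁ h₁ K'} {φ₂ : Cell J' g₂ h₂ K'}
    (hJ₁ : J₁' = J₁.comp J') (hK₁ : K₁' = K₁.comp K'.toPath)
    (hJ₂ : J₂' = J₂.comp J') (hK₂ : K₂' = K₂.comp K'.toPath)
    (hJ : J₁ = J₂) (hf : f₁ = f₂) (hg : g₁ = g₂) (hK : K₁ = K₂) (hh : h₁ = h₂)
    (hΦ : HEq Φ₁ Φ₂) (hφ : HEq φ₁ φ₂) :
    HEq (snoc Φ₁ φ₁ hJ₁ hK₁) (snoc Φ₂ φ₂ hJ₂ hK₂) := by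
  subst hJ hf hg hK hh hΦ hφ hJ₁ hK₁ hJ₂ hK₂
  rfl

theorem nil_append {A B C D : 𝒦} {J : HPath Hor A B} {f : A ⟶ C} {g : B ⟶ D}
    {K : HPath Hor C D} (Φ : CellPath J f g K) : HEq ((nil f).append Φ) Φ := by
  induction Φ with
  | nil f => rfl
  | snoc Φ φ hJ hK ih =>
    exact snoc_heq _ _ _ _ (by simp) rfl rfl (by simp) rfl ih HEq.rfl

theorem append_assoc {A B C D B' D' B'' D'' : 𝒦} {J : HPath Hor A B} {f : A ⟶ C} {g : B ⟶ D}
    {K : HPath Hor C D} {J' : HPath Hor B B'} {h : B' ⟶ D'} {K' : HPath Hor D D'}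
    {J'' : HPath Hor B' B''} {k : B'' ⟶ D''} {K'' : HPath Hor D' D''}
    (Φ : CellPath J f g K) (Ψ : CellPath J' g h K') (Ω : CellPath J'' h k K'') :
    HEq ((Φ.append Ψ).append Ω) (Φ.append (Ψ.append Ω)) := by
  induction Ω with
  | nil f => rfl
  | snoc Ω φ hJ hK ih =>
    exact snoc_heq _ _ _ _ (by simp) rfl rfl (by simp) rfl (ih Ψ) HEq.rfl

theorem append_heq_right {A B C D B' D' : 𝒦} {J : HPath Hor A B} {f : A ⟶ C} {g : B ⟶ D}
    {K : HPath Hor C D} {J₁ J₂ : HPath Hor B B'} {h : B' ⟶ D'} {K₁ K₂ : HPath Hor D D'}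
    (Φ : CellPath J f g K) {Ψ₁ : CellPath J₁ g h K₁} {Ψ₂ : CellPath J₂ g h K₂}
    (hJ : J₁ = J₂) (hK : K₁ = K₂) (hΨ : HEq Ψ₁ Ψ₂) :
    HEq (Φ.append Ψ₁) (Φ.append Ψ₂) := by
  subst hJ hK hΨ
  rfl

theorem exists_heq {A B C D : 𝒦} {J J' : HPath Hor A B} {f : A ⟶ C} {g : B ⟶ D}
    {K : HPath Hor C D} (hJ : J' = J) (Φ : CellPath J f g K) :
    ∃ Φ' : CellPath J' f g K, HEq Φ' Φ := by
  subst hJ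
  exact ⟨Φ, HEq.rfl⟩

end CellPath

/-! ### Grids of cells and interchange -/

section

variable {𝒦 : Type u} [AugmentedVirtualDoubleData.{u, v, w, t} 𝒦]

theorem single_idHor_append_idPath {A B C : 𝒦} (J : Hor A B) (T : HPath Hor B C) :
    (CellPath.single (idHor J)).append (idPath T) = idPath ((HPath.single J).comp T) := by
  induction T with
  | nil => rfl
  | cons T I ih =>
    change CellPath.snoc _ _ _ _ = CellPath.snoc _ _ _ _
    rw [ih]

theorem vcomp_heq {A B C D E F : 𝒦} {J₁ J₂ : HPath Hor A B} {f₁ f₂ : A ⟶ C} {g₁ g₂ : B ⟶ D}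
    {K₁ K₂ : HPath Hor C D} {h₁ h₂ : C ⟶ E} {k₁ k₂ : D ⟶ F} {L : ShortPath Hor E F}
    {f₁' f₂' : A ⟶ E} {g₁' g₂' : B ⟶ F} {Φ₁ : CellPath J₁ f₁ g₁ K₁} {Φ₂ : CellPath J₂ f₂ g₂ K₂}
    {ψ₁ : Cell K₁ h₁ k₁ L} {ψ₂ : Cell K₂ h₂ k₂ L}
    (hf₁ : f₁' = f₁ ≫ h₁) (hg₁ : g₁' = g₁ ≫ k₁) (hf₂ : f₂' = f₂ ≫ h₂) (hg₂ : g₂' = g₂ ≫ k₂)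
    (hJ : J₁ = J₂) (hf : f₁ = f₂) (hg : g₁ = g₂) (hK : K₁ = K₂) (hh : h₁ = h₂) (hk : k₁ = k₂)
    (hΦ : HEq Φ₁ Φ₂) (hψ : HEq ψ₁ ψ₂) :
    HEq (vcomp Φ₁ ψ₁ hf₁ hg₁) (vcomp Φ₂ ψ₂ hf₂ hg₂) := by
  subst hJ hf hg hK hh hk hΦ hψ hf₁ hg₁ hf₂ hg₂
  rfl

/-- The paths `Φ` and `Ψ` form a grid of cells whose columns have composites `Ω`. -/
def Interchange {A B C D E F : 𝒦} {J : HPath Hor A B} {f : A ⟶ C} {g : B ⟶ D}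
    {K : HPath Hor C D} {h : C ⟶ E} {k : D ⟶ F} {L : HPath Hor E F} {f' : A ⟶ E} {g' : B ⟶ F}
    (Φ : CellPath J f g K) (Ψ : CellPath K h k L) (Ω : CellPath J f' g' L) : Prop :=
  f' = f ≫ h ∧ g' = g ≫ k ∧
    ∃ S : CellGrid J f g K h k L, S.top = Φ ∧ S.bottom = Ψ ∧ HEq S.composite Ω

namespace Interchange

theorem nil {A C E : 𝒦} (f : A ⟶ C) (h : C ⟶ E) :
    Interchange (.nil f) (.nil h) (.nil (f ≫ h)) :=
  ⟨rfl, rfl, .nil f h, rfl, rfl, HEq.rfl⟩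

theorem snoc {A B C D E F B' D' F' : 𝒦} {J : HPath Hor A B} {f : A ⟶ C} {g : B ⟶ D}
    {K : HPath Hor C D} {h : C ⟶ E} {k : D ⟶ F} {L : HPath Hor E F} {f' : A ⟶ E} {m : B ⟶ F}
    {Φ : CellPath J f g K} {Ψ : CellPath K h k L} {Ω : CellPath J f' m L}
    (H : Interchange Φ Ψ Ω)
    {J' : HPath Hor B B'} {g' : B' ⟶ D'} {K' : HPath Hor D D'} {k' : D' ⟶ F'}
    {L' : ShortPath Hor F F'} (Φ' : CellPath J' g g' K') (ψ : Cell K' k k' L')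
    {m' : B' ⟶ F'} (hm : m = g ≫ k) (hm' : m' = g' ≫ k')
    {J'' : HPath Hor A B'} {K'' : HPath Hor C D'} {L'' : HPath Hor E F'}
    (hJ : J'' = J.comp J') (hK : K'' = K.comp K') (hL : L'' = L.comp L'.toPath)
    {Φ'' : CellPath J'' f g' K''} (hΦ : HEq Φ'' (Φ.append Φ')) :
    Interchange Φ'' (.snoc Ψ ψ hK hL) (.snoc Ω (vcomp Φ' ψ hm hm') hJ hL) := by
  obtain ⟨rfl, -, S, rfl, rfl, hΩ⟩ := H
  subst hJ hK hL hm hm' hΦ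
  cases hΩ
  exact ⟨rfl, rfl, S.snoc Φ' ψ, rfl, rfl, HEq.rfl⟩

theorem single {A B C D E F : 𝒦} {J : HPath Hor A B} {f : A ⟶ C} {g : B ⟶ D}
    {K : HPath Hor C D} {h : C ⟶ E} {k : D ⟶ F} {L : ShortPath Hor E F}
    (Φ : CellPath J f g K) (ψ : Cell K h k L) {f' : A ⟶ E} {g' : B ⟶ F}
    (hf : f' = f ≫ h) (hg : g' = g ≫ k) :
    Interchange Φ (.single ψ) (.single (vcomp Φ ψ hf hg)) := by
  subst hf
  exact (nil f h).snoc Φ ψ rfl hg (by simp) (by simp) (by simp) (CellPath.nil_append Φ).symm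

end Interchange

end

namespace AugmentedVirtualDoubleCategory

variable {𝒦 : Type u} [AugmentedVirtualDoubleCategory.{u, v, w, t} 𝒦]

/-- The associativity axiom with all vertical boundaries left free up to given equations, so that
identities such as `f ≫ 𝟙 _ = f` can be absorbed without casts. -/
theorem _root_.Interchange.vcomp_eq {A B C D E F X Y : 𝒦} {J : HPath Hor A B} {f : A ⟶ C}
    {g : B ⟶ D} {K : HPath Hor C D} {h : C ⟶ E} {k : D ⟶ F} {L : HPath Hor E F}
    {f' : A ⟶ E} {g' : B ⟶ F} {Φ : CellPath J f g K} {Ψ : CellPath K h k L}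
    {Ω : CellPath J f' g' L} (H : Interchange Φ Ψ Ω) {p : E ⟶ X} {q : F ⟶ Y}
    {N : ShortPath Hor X Y} (χ : Cell L p q N) {a : A ⟶ X} {b : B ⟶ Y} {c : C ⟶ X} {e : D ⟶ Y}
    (ha : a = f' ≫ p) (hb : b = g' ≫ q) (hc : c = h ≫ p) (he : e = k ≫ q)
    (ha' : a = f ≫ c) (hb' : b = g ≫ e) :
    vcomp Ω χ ha hb = vcomp Φ (vcomp Ψ χ hc he) ha' hb' := by
  obtain ⟨rfl, rfl, S, rfl, rfl, hΩ⟩ := H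
  cases hΩ
  subst hc he ha' hb'
  exact vcomp_assoc S χ

/-! ### Calculus of composites -/

theorem vcomp_single_assoc {A B C D E F X Y : 𝒦} {J : HPath Hor A B} {f : A ⟶ C}
    {g : B ⟶ D} {K : HPath Hor C D} {h : C ⟶ E} {k : D ⟶ F} {L : ShortPath Hor E F}
    {f' : A ⟶ E} {g' : B ⟶ F} (Φ : CellPath J f g K) (ψ : Cell K h k L)
    (hf : f' = f ≫ h) (hg : g' = g ≫ k) {p : E ⟶ X} {q : F ⟶ Y}
    {N : ShortPath Hor X Y} (χ : Cell L.toPath p q N)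
    {a : A ⟶ X} {b : B ⟶ Y} {c : C ⟶ X} {e : D ⟶ Y}
    (ha : a = f' ≫ p) (hb : b = g' ≫ q) (hc : c = h ≫ p) (he : e = k ≫ q)
    (ha' : a = f ≫ c) (hb' : b = g ≫ e) :
    vcomp (.single (vcomp Φ ψ hf hg)) χ ha hb =
      vcomp Φ (vcomp (.single ψ) χ hc he) ha' hb' :=
  (Interchange.single Φ ψ hf hg).vcomp_eq χ ha hb hc he ha' hb'

theorem vcomp_nil_id {C E F : 𝒦} {h : C ⟶ E} {k : C ⟶ F} {L : ShortPath Hor E F}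
    (ψ : Cell (.nil : HPath Hor C C) h k L) (hf : h = 𝟙 C ≫ h) (hg : k = 𝟙 C ≫ k) :
    vcomp (.nil (𝟙 C)) ψ hf hg = ψ :=
  idPath_vcomp ψ

theorem vcomp_single_idVer {A C E F : 𝒦} (f : A ⟶ C) {h : C ⟶ E} {k : C ⟶ F}
    {L : ShortPath Hor E F} (ψ : Cell .nil h k L) {a : A ⟶ E} {b : A ⟶ F}
    (ha : a = f ≫ h) (hb : b = f ≫ k) :
    vcomp (.single (idVer f)) ψ ha hb = vcomp (.nil f) ψ ha hb := by
  subst ha hb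
  exact vcomp_idVer (.nil f) (.nil f) ψ

theorem idCell_vcomp {C D E F : 𝒦} {K : ShortPath Hor C D} {h : C ⟶ E} {k : D ⟶ F}
    {L : ShortPath Hor E F} (ψ : Cell K.toPath h k L) (hf : h = 𝟙 C ≫ h) (hg : k = 𝟙 D ≫ k) :
    vcomp (.single (idCell K)) ψ hf hg = ψ := by
  cases K with
  | nil => exact (vcomp_single_idVer _ _ _ _).trans (idPath_vcomp ψ)
  | single J => exact idPath_vcomp ψ

theorem vcomp_nil_idVer {A C E : 𝒦} (f : A ⟶ C) (h : C ⟶ E) {a b : A ⟶ E} (ha : a = f ≫ h)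
    (hb : b = f ≫ h) : HEq (vcomp (.nil f) (idVer h) ha hb) (idVer (f ≫ h)) := by
  -- The case `h = 𝟙`: the empty path at `g` may be replaced by the cell `idVer g`, and the unit law
  -- applies.
  have key : ∀ {X Y : 𝒦} (g : X ⟶ Y), vcomp (.nil g) (idVer (𝟙 Y)) (Category.comp_id g).symm
      (Category.comp_id g).symm = idVer g := fun g =>
    (vcomp_single_idVer g _ _ _).symm.trans (vcomp_idCell (K := .nil) (idVer g))
  subst ha hb
  -- Associativity for the empty grid, followed by `idVer (𝟙 E)`, reduces the general case to the
  -- previous one.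
  have h2 := (Interchange.nil f h).vcomp_eq (idVer (𝟙 E)) (Category.comp_id _).symm
    (Category.comp_id _).symm (Category.comp_id _).symm (Category.comp_id _).symm rfl rfl
  rw [key, key] at h2
  exact heq_of_eq h2.symm

/-- `id_f ⊙ χ = χ`. -/
theorem idVer_pair_vcomp {M N B K : 𝒦} {P : HPath Hor M B} {f : M ⟶ N} {h : B ⟶ K}
    {L : ShortPath Hor N K} (χ : Cell P f h L) (hP : P = HPath.nil.comp P)
    (hL : L.toPath = HPath.nil.comp L.toPath) (hf : f = f ≫ 𝟙 N) (hh : h = h ≫ 𝟙 K) :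
    vcomp (.snoc (.single (idVer f)) χ hP hL) (idCell L) hf hh = χ := by
  -- `ψ` is the identity cell retyped with source `nil.comp L.toPath`, the form in which
  -- `vcomp_idVer` removes the leading `idVer f`.
  obtain ⟨ψ, hψ⟩ : ∃ ψ : Cell (HPath.nil.comp L.toPath) (𝟙 N) (𝟙 K) L, HEq ψ (idCell L) := by
    rw [HPath.nil_comp]
    exact ⟨_, HEq.rfl⟩
  have h1 := vcomp_idVer (.nil f) (.single χ) ψ
  refine eq_of_heq (HEq.trans ?_ ((heq_of_eq h1).trans ?_))
  · exact vcomp_heq _ _ _ _ (by simp) rfl rfl (by simp) rfl rfl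
      (CellPath.snoc_heq _ _ _ _ rfl rfl rfl rfl rfl HEq.rfl HEq.rfl) hψ.symm
  · exact (vcomp_heq _ _ (Category.comp_id _).symm (Category.comp_id _).symm (by simp) rfl rfl
      (by simp) rfl rfl (CellPath.nil_append (.single χ)) hψ).trans (heq_of_eq (vcomp_idCell χ))

theorem idVer_hcomp {M N B K : 𝒦} {P : HPath Hor M B} {f : M ⟶ N} {h : B ⟶ K}
    {L : ShortPath Hor N K} (χ : Cell P f h L) : HEq (hcomp (idVer f) χ) χ :=
  (vcomp_heq (Category.comp_id _).symm (Category.comp_id _).symm _ _ (by simp) rfl rfl rfl rfl rfl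
    (CellPath.snoc_heq _ (HPath.nil_comp _).symm (HPath.nil_comp _).symm _ rfl rfl rfl rfl rfl
      HEq.rfl HEq.rfl) HEq.rfl).trans
    (heq_of_eq (idVer_pair_vcomp χ (HPath.nil_comp _).symm (HPath.nil_comp _).symm
      (Category.comp_id _).symm (Category.comp_id _).symm))

theorem hcomp_idVer {A B M : 𝒦} {J : HPath Hor A B} {d : A ⟶ M} {l : B ⟶ M}
    (η : Cell J d l .nil) : hcomp η (idVer l) = η := by
  have h := vcomp_idVer (.single η) (.nil l) (idVer (𝟙 M))
  have h' := vcomp_idCell η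
  refine eq_of_heq (HEq.trans ?_ ((heq_of_eq h).trans (HEq.trans ?_ (heq_of_eq h'))))
  · exact vcomp_heq _ _ _ _ rfl rfl rfl rfl rfl rfl HEq.rfl HEq.rfl
  · exact vcomp_heq _ _ _ _ rfl rfl rfl rfl rfl rfl HEq.rfl HEq.rfl

/-- Composition with a pair `(η, φ)` factors through the columns of a grid. -/
theorem vcomp_hcomp {A B B' C D C' D' E : 𝒦} {J : HPath Hor A B} {H : HPath Hor B B'}
    {f : A ⟶ C} {g : B ⟶ D} {g' : B' ⟶ D'} {K : HPath Hor C D} {P : HPath Hor D D'}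
    {h : C ⟶ E} {k : D ⟶ E} {m : D' ⟶ C'} {L : ShortPath Hor E C'}
    (Φ : CellPath J f g K) (Γ : CellPath H g g' P) (η : Cell K h k .nil) (φ : Cell P k m L)
    {a : A ⟶ E} {b : B ⟶ E} {c : B' ⟶ C'}
    (ha : a = f ≫ h) (hb : b = g ≫ k) (hc : c = g' ≫ m) :
    vcomp (Φ.append Γ) (hcomp η φ) ha hc = hcomp (vcomp Φ η ha hb) (vcomp Γ φ hb hc) :=
  (((Interchange.single Φ η ha hb).snoc Γ φ hb hc rfl rfl (HPath.nil_comp _).symm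
    HEq.rfl).vcomp_eq (idCell L) _ _ _ _ _ _).symm

/-- `ψ ∘ (η ⊙ φ) = (p ∘ η) ⊙ (ψ ∘ φ)`. -/
theorem hcomp_vcomp {A B B' C D E F : 𝒦} {J : HPath Hor A B} {H : HPath Hor B B'}
    {f : A ⟶ C} {g : B ⟶ C} {h : B' ⟶ D} {L : ShortPath Hor C D} (η : Cell J f g .nil)
    (φ : Cell H g h L) {p : C ⟶ E} {q : D ⟶ F} {K : ShortPath Hor E F} (ψ : Cell L.toPath p q K)
    {a : A ⟶ E} {b : B ⟶ E} {c : B' ⟶ F} (ha : a = f ≫ p) (hb : b = g ≫ p) (hc : c = h ≫ q) :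
    vcomp (.single (hcomp η φ)) ψ ha hc =
      hcomp (vcomp (.single η) (idVer p) ha hb) (vcomp (.single φ) ψ hb hc) := by
  -- Grid with top `(η, φ)` and bottom `(id_p, ψ)`: its bottom row composes to `ψ`, so the
  -- right-hand side is `ψ ∘ (η, φ)`. The left-hand side reduces to the same by associativity and
  -- the unit law.
  have h1 := ((Interchange.single (.single η) (idVer p) ha hb).snoc (.single φ) ψ hb hc rfl
    (HPath.nil_comp _).symm (HPath.nil_comp _).symm
    (Φ'' := .snoc (.single η) φ rfl (HPath.nil_comp _).symm)
    (CellPath.snoc_heq _ _ _ _ rfl rfl rfl (by simp) rfl HEq.rfl HEq.rfl)).vcomp_eq (idCell K)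
      (Category.comp_id _).symm (Category.comp_id _).symm (Category.comp_id _).symm
      (Category.comp_id _).symm ha hc
  rw [idVer_pair_vcomp] at h1
  refine Eq.trans ?_ h1.symm
  refine (vcomp_single_assoc _ _ _ _ ψ ha hc (Category.id_comp _).symm (Category.id_comp _).symm
    ha hc).trans ?_
  rw [idCell_vcomp]

/-- Interchange of a path of cells on the left with identity cells on the right. -/
theorem interchange_append_idPath {A B C D E : 𝒦} {J : HPath Hor A B} {f : A ⟶ C}
    {K : HPath Hor C B} {h : C ⟶ E} {L : ShortPath Hor E B} (Φ : CellPath J f (𝟙 B) K)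
    (ψ : Cell K h (𝟙 B) L) {a : A ⟶ E} (ha : a = f ≫ h) (hb : 𝟙 B = 𝟙 B ≫ 𝟙 B)
    (T : HPath Hor B D) :
    Interchange (Φ.append (idPath T)) ((CellPath.single ψ).append (idPath T))
      ((CellPath.single (vcomp Φ ψ ha hb)).append (idPath T)) := by
  induction T with
  | nil => exact .single Φ ψ ha hb
  | cons T I ih =>
    have h1 := ih.snoc (.single (idHor I)) (idHor I) (Category.comp_id _).symm
      (Category.comp_id _).symm rfl rfl rfl
      (Φ'' := Φ.append (idPath (T.cons I)))
      (CellPath.snoc_heq _ _ _ _ rfl rfl rfl rfl rfl HEq.rfl HEq.rfl)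
    have h2 := vcomp_idCell (K := .single I) (idHor I)
    change vcomp _ (idHor I) _ _ = _ at h2
    rw [h2] at h1
    exact h1

/-! ### Cartesian cells -/

theorem IsCartesian.existsUnique {A B C D : 𝒦} {J : Hor A B} {f : A ⟶ C} {g : B ⟶ D}
    {K : ShortPath Hor C D} {ψ : Cell (.single J) f g K} (hψ : IsCartesian ψ) {X Y : 𝒦}
    {H : HPath Hor X Y} {h : X ⟶ A} {k : Y ⟶ B} {a : X ⟶ C} {b : Y ⟶ D} (χ : Cell H a b K)
    (ha : a = h ≫ f) (hb : b = k ≫ g) :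
    ∃! φ : Cell H h k (.single J), vcomp (.single φ) ψ ha hb = χ := by
  subst ha hb
  exact hψ H h k χ

theorem IsCartesian.bijective {A B C D : 𝒦} {J : Hor A B} {f : A ⟶ C} {g : B ⟶ D}
    {K : ShortPath Hor C D} {ψ : Cell (.single J) f g K} (hψ : IsCartesian ψ) {X Y : 𝒦}
    (H : HPath Hor X Y) (h : X ⟶ A) (k : Y ⟶ B) {a : X ⟶ C} {b : Y ⟶ D}
    (ha : a = h ≫ f) (hb : b = k ≫ g) :
    Function.Bijective
      (fun φ : Cell H h k (.single J) => vcomp (.single φ) ψ ha hb) :=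
  Function.bijective_iff_existsUnique _ |>.2 fun χ => hψ.existsUnique χ ha hb

/-- Makes `J` its own restriction `J(id, id)`, whereby unrestricted conditions become instances of
pointwise ones. -/
theorem isCartesian_idHor {A B : 𝒦} (J : Hor A B) : IsCartesian (idHor J) := by
  intro X Y H h k ω
  have key : ∀ {a : X ⟶ A} {b : Y ⟶ B} (ha : a = h) (hb : b = k) (ha' : a = h ≫ 𝟙 A)
      (hb' : b = k ≫ 𝟙 B) (χ : Cell H a b (.single J)),
      ∃! φ : Cell H h k (.single J), vcomp (.single φ) (idHor J) ha' hb' = χ := by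
    intro a b ha hb ha' hb' χ
    subst ha hb
    exact ⟨χ, vcomp_idCell χ, fun φ hφ => (vcomp_idCell φ).symm.trans hφ⟩
  exact key (Category.comp_id h) (Category.comp_id k) _ _ ω

/-- Pasting of cartesian cells. -/
theorem IsCartesian.vcomp_iff {A B C D E F : 𝒦} {J : Hor A B} {f : A ⟶ C} {g : B ⟶ D}
    {K : Hor C D} {c : Cell (.single J) f g (.single K)} {h : C ⟶ E} {k : D ⟶ F}
    {L : ShortPath Hor E F} {ψ : Cell (.single K) h k L} (hψ : IsCartesian ψ) {a : A ⟶ E}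
    {b : B ⟶ F} (ha : a = f ≫ h) (hb : b = g ≫ k) :
    IsCartesian (vcomp (.single c) ψ ha hb) ↔ IsCartesian c := by
  subst ha hb
  have key : ∀ {X Y : 𝒦} {H : HPath Hor X Y} {p : X ⟶ A} {q : Y ⟶ B}
      (φ : Cell H p q (.single J)),
      vcomp (.single φ) (vcomp (.single c) ψ rfl rfl) rfl rfl =
        vcomp (.single (vcomp (.single φ) c rfl rfl)) ψ (Category.assoc _ _ _).symm
          (Category.assoc _ _ _).symm := fun φ =>
    (vcomp_single_assoc _ c _ _ _ _ _ _ _ _ _).symm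
  simp only [IsCartesian, ← Function.bijective_iff_existsUnique]
  refine forall₅_congr fun X Y H p q => ?_
  -- The map for the pasted cell is the map for `c` followed by the bijection given by `ψ`.
  simp only [key]
  exact (hψ.bijective H (p ≫ f) (q ≫ g) _ _).of_comp_iff' _

/-! ### Precomposition with invertible paths of cells -/

/-- Precomposition with the path `Γ` is a bijection on cells. -/
def PrecompBijective {A B : 𝒦} {J K : HPath Hor A B} (Γ : CellPath J (𝟙 A) (𝟙 B) K) : Prop :=
  ∀ ⦃C D : 𝒦⦄ (f : A ⟶ C) (g : B ⟶ D) (L : ShortPath Hor C D),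
    Function.Bijective (fun φ : Cell K f g L =>
      vcomp Γ φ (Category.id_comp f).symm (Category.id_comp g).symm)

theorem precompBijective_nil (A : 𝒦) :
    PrecompBijective (J := .nil) (.nil (𝟙 A)) := by
  intro C D f g L
  convert Function.bijective_id with φ
  exact vcomp_nil_id _ _ _

theorem vcomp_append_idPath {A B B' C D : 𝒦} {J K : HPath Hor A B} {L : ShortPath Hor A B}
    (Φ : CellPath J (𝟙 A) (𝟙 B) K) (ψ : Cell K (𝟙 A) (𝟙 B) L) (T : HPath Hor B B')
    {f : A ⟶ C} {g : B' ⟶ D} {N : ShortPath Hor C D} (χ : Cell (L.toPath.comp T) f g N) :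
    vcomp (Φ.append (idPath T)) (vcomp ((CellPath.single ψ).append (idPath T)) χ
        (Category.id_comp f).symm (Category.id_comp g).symm)
        (Category.id_comp f).symm (Category.id_comp g).symm =
      vcomp ((CellPath.single (vcomp Φ ψ (Category.id_comp _).symm
        (Category.id_comp _).symm)).append (idPath T)) χ
        (Category.id_comp f).symm (Category.id_comp g).symm :=
  ((interchange_append_idPath Φ ψ _ _ T).vcomp_eq χ _ _ _ _ _ _).symm

theorem vcomp_single_idHor_append_idPath {A B B' C D : 𝒦} (J : Hor A B) (T : HPath Hor B B')
    {f : A ⟶ C} {g : B' ⟶ D} {N : ShortPath Hor C D}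
    (χ : Cell ((HPath.single J).comp T) f g N) :
    vcomp ((CellPath.single (idHor J)).append (idPath T)) χ
      (Category.id_comp f).symm (Category.id_comp g).symm = χ := by
  have h : ∀ Γ, Γ = idPath ((HPath.single J).comp T) →
      vcomp Γ χ (Category.id_comp f).symm (Category.id_comp g).symm = χ := by
    rintro _ rfl
    exact idPath_vcomp χ
  exact h _ (single_idHor_append_idPath J T)

/-- A cartesian cell with trivial vertical source and target is invertible. -/
theorem IsCartesian.exists_inverse {A B : 𝒦} {R K : Hor A B}
    {c : Cell (.single R) (𝟙 A) (𝟙 B) (.single K)} (hc : IsCartesian c) :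
    ∃ c' : Cell (.single K) (𝟙 A) (𝟙 B) (.single R),
      vcomp (.single c') c (Category.id_comp _).symm (Category.id_comp _).symm = idHor K ∧
      vcomp (.single c) c' (Category.id_comp _).symm (Category.id_comp _).symm = idHor R := by
  obtain ⟨c', h, -⟩ := hc.existsUnique (idHor K) (Category.id_comp _).symm
    (Category.id_comp _).symm
  -- For the other inverse law, composition with `c` is injective and sends both sides to `c`.
  refine ⟨c', h, (hc.bijective _ _ _ (Category.id_comp _).symm (Category.id_comp _).symm).1 ?_⟩
  have h1 := vcomp_single_assoc (.single c) c' (Category.id_comp _).symm (Category.id_comp _).symm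
    c (Category.id_comp _).symm (Category.id_comp _).symm (Category.id_comp _).symm
    (Category.id_comp _).symm (Category.id_comp _).symm (Category.id_comp _).symm
  rw [h] at h1
  exact h1.trans ((vcomp_idCell c).trans (idCell_vcomp (K := .single R) c _ _).symm)

/-- The inverse of `c` gives the inverse map. Since `η'` has trivial vertical target, the cartesian
cells in the definition of right cocartesian are of this kind, so they only enlarge the path `H` and
add no further condition. -/
theorem IsCartesian.precompBijective {A B B' : 𝒦} {R K : Hor A B}
    {c : Cell (.single R) (𝟙 A) (𝟙 B) (.single K)} (hc : IsCartesian c) (T : HPath Hor B B') :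
    PrecompBijective ((CellPath.single c).append (idPath T)) := by
  obtain ⟨c', h, h'⟩ := hc.exists_inverse
  intro C D f g L
  refine Function.bijective_iff_has_inverse.2
    ⟨fun φ => vcomp ((CellPath.single c').append (idPath T)) φ
      (Category.id_comp f).symm (Category.id_comp g).symm, fun φ => ?_, fun φ => ?_⟩
  · refine (vcomp_append_idPath (.single c') c T φ).trans ?_
    rw [h]
    exact vcomp_single_idHor_append_idPath K T φ
  · refine (vcomp_append_idPath (.single c) c' T φ).trans ?_
    rw [h']
    exact vcomp_single_idHor_append_idPath R T φ

/-! ### Conjoints -/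

/-- The composite `f ∘ cart` for the cartesian cell of a conjoint. -/
def postcompConjoint {B M N : 𝒦} {S : Hor M B} {l : B ⟶ M}
    (cart : Cell (.single S) (𝟙 M) l .nil) (f : M ⟶ N) : Cell (.single S) f (l ≫ f) .nil :=
  vcomp (.single cart) (idVer f) (Category.id_comp f).symm rfl

/-- The conjoint identities. -/
theorem IsCartesian.exists_cocartesian {B M : 𝒦} {S : Hor M B} {l : B ⟶ M}
    {cart : Cell (.single S) (𝟙 M) l .nil} (hcart : IsCartesian cart) :
    ∃ ω : Cell .nil l (𝟙 B) (.single S),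
      vcomp (.single ω) cart (Category.comp_id l).symm (Category.id_comp l).symm = idVer l ∧
      hcomp cart ω = idHor S := by
  obtain ⟨ω, h, -⟩ := hcart.existsUnique (idVer l) (Category.comp_id l).symm
    (Category.id_comp l).symm
  -- For the second identity, composition with `cart` is injective and sends both `cart ⊙ ω` and
  -- `id_S` to `cart`.
  refine ⟨ω, h, (hcart.bijective _ _ _ (Category.id_comp _).symm (Category.id_comp _).symm).1 ?_⟩
  have h1 := hcomp_vcomp cart ω cart (Category.id_comp _).symm (Category.comp_id l).symm
    (Category.id_comp l).symm
  rw [h, hcomp_idVer] at h1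
  exact h1.trans ((vcomp_idCell cart).trans (idCell_vcomp (K := .single S) cart _ _).symm)

/-- Cells out of `S ⌢ H`, with `S` the conjoint of `l`, correspond to cells out of `H`. -/
theorem IsCartesian.hcomp_bijective {B B' M N K : 𝒦} {S : Hor M B} {l : B ⟶ M}
    {cart : Cell (.single S) (𝟙 M) l .nil} (hcart : IsCartesian cart) (f : M ⟶ N)
    (H : HPath Hor B B') (h : B' ⟶ K) (L : ShortPath Hor N K) :
    Function.Bijective
      (fun φ : Cell H (l ≫ f) h L => hcomp (postcompConjoint cart f) φ) := by
  obtain ⟨ω, h1, h2⟩ := hcart.exists_cocartesian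
  constructor
  -- Left inverse: precomposing with `ω` at `S` turns `f ∘ cart` into the identity cell of `l ≫ f`,
  -- leaving `φ`.
  · have key : ∀ φ : Cell H (l ≫ f) h L,
        HEq (vcomp ((CellPath.single ω).append (idPath H)) (hcomp (postcompConjoint cart f) φ)
          rfl (Category.id_comp h).symm) φ := by
      intro φ
      refine (heq_of_eq (vcomp_hcomp (.single ω) (idPath H) (postcompConjoint cart f) φ rfl
        (Category.id_comp _).symm (Category.id_comp h).symm)).trans ?_
      rw [idPath_vcomp φ]
      have h3 := vcomp_single_assoc (.single ω) cart (Category.comp_id l).symm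
        (Category.id_comp l).symm (idVer f) rfl rfl (Category.id_comp f).symm rfl rfl
        (Category.id_comp _).symm
      rw [h1, vcomp_single_idVer] at h3
      unfold postcompConjoint
      rw [← h3, eq_of_heq (vcomp_nil_idVer l f rfl rfl)]
      exact idVer_hcomp φ
    intro φ φ' hφ
    refine eq_of_heq ((key φ).symm.trans (HEq.trans (heq_of_eq ?_) (key φ')))
    exact congrArg (fun χ => vcomp ((CellPath.single ω).append (idPath H)) χ
          rfl (Category.id_comp h).symm) hφ
  · intro χ
    -- The preimage of `χ` is its composite with `ω ⌢ id_H`, retyped to have source `H`. Composing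
    -- back yields `χ ∘ ((cart, ω) ⌢ id_H)`, which is `χ` because `cart ⊙ ω = id_S`.
    obtain ⟨Ω, hΩ⟩ := CellPath.exists_heq (HPath.nil_comp H).symm
      ((CellPath.single ω).append (idPath H))
    refine ⟨vcomp Ω χ rfl (Category.id_comp h).symm, ?_⟩
    let Ψ : CellPath (HPath.single S) (𝟙 M) (𝟙 B) (HPath.single S) :=
      .snoc (.single cart) ω rfl rfl
    have h3 := ((Interchange.single (.single cart) (idVer f) (Category.id_comp f).symm rfl).snoc Ω χ
      rfl (Category.id_comp h).symm rfl (HPath.nil_comp _).symm (HPath.nil_comp _).symm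
      (Φ'' := Ψ.append (idPath H))
      ((CellPath.append_assoc (.single cart) (.single ω) (idPath H)).trans
        (CellPath.append_heq_right _ (HPath.nil_comp H) rfl hΩ.symm))).vcomp_eq (idCell L)
      (Category.comp_id _).symm (Category.comp_id _).symm (Category.comp_id _).symm
      (Category.comp_id _).symm (Category.id_comp _).symm (Category.id_comp _).symm
    refine h3.trans ?_
    rw [idVer_pair_vcomp]
    have h4 := vcomp_append_idPath Ψ (idHor S) H χ
    have h5 : vcomp Ψ (idHor S) (Category.id_comp _).symm (Category.id_comp _).symm = idHor S := h2
    rw [h5, vcomp_single_idHor_append_idPath] at h4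
    exact h4

/-! ### Factorisations through a nullary cell -/

/-- Factorisation of cells `J ⌢ H ⇒ L` through `η` is unique, for fixed `H`. -/
def FactorsAt {A B N : 𝒦} {J : HPath Hor A B} {d : A ⟶ N} {l : B ⟶ N} (η : Cell J d l .nil)
    {B' K : 𝒦} (H : HPath Hor B B') (L : ShortPath Hor N K) (h : B' ⟶ K) : Prop :=
  Function.Bijective (fun φ : Cell H l h L => hcomp η φ)

/-- Unique factorisation of all cells `J ⌢ H ⇒ L` with `L` among the allowed targets. -/
def FactorsTo (s : Variant) (r : Targets) {A B N : 𝒦} {J : HPath Hor A B} {d : A ⟶ N} {l : B ⟶ N}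
    (η : Cell J d l .nil) : Prop :=
  ∀ ⦃B' K : 𝒦⦄ (H : HPath Hor B B') (L : ShortPath Hor N K) (h : B' ⟶ K),
    s.Allows H → r.Allows L → FactorsAt η H L h

theorem factorsTo_congr {s : Variant} {r : Targets} {A B N : 𝒦} {J : HPath Hor A B}
    {d d' : A ⟶ N} {l l' : B ⟶ N} {η : Cell J d l .nil} {η' : Cell J d' l' .nil}
    (hd : d = d') (hl : l = l') (hη : HEq η η') : FactorsTo s r η ↔ FactorsTo s r η' := by
  subst hd hl hη
  rfl

theorem isLeftKan_iff {s : Variant} {A B M : 𝒦} {J : HPath Hor A B} {d : A ⟶ M} {l : B ⟶ M}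
    {η : Cell J d l .nil} : IsLeftKan s η ↔ FactorsTo s .nullary η := by
  constructor
  · intro H B' K P L h hP hL
    cases L with
    | nil => exact (Function.bijective_iff_existsUnique _).2 fun φ => H P h φ hP
    | single L => exact hL.elim
  · intro H B' P k φ hP
    exact (Function.bijective_iff_existsUnique _).1 (H P .nil k hP trivial) φ

theorem factors_iff {s : Variant} {A B M : 𝒦} {J : HPath Hor A B} {d : A ⟶ M} {l : B ⟶ M}
    {η : Cell J d l .nil} : Factors s η ↔ FactorsTo s .all η :=
  ⟨fun H _ _ P L h hP _ => (Function.bijective_iff_existsUnique _).2 fun φ => H P L h φ hP,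
    fun H _ _ P L h φ hP =>
      (Function.bijective_iff_existsUnique _).1 (H P L h hP trivial) φ⟩

theorem factorsAfterAll_iff {s : Variant} {A B M : 𝒦} {J : HPath Hor A B} {d : A ⟶ M}
    {l : B ⟶ M} {η : Cell J d l .nil} :
    FactorsAfterAll s η ↔ ∀ ⦃N : 𝒦⦄ (f : M ⟶ N), FactorsTo s .all (postcomp η f) :=
  ⟨fun H _ f => factors_iff.1 fun _ _ P L h φ hP => H f P L h φ hP,
    fun H _ _ _ f P L h φ hP => factors_iff.2 (H f) P L h φ hP⟩

theorem FactorsTo.nullary {s : Variant} {A B M : 𝒦} {J : HPath Hor A B} {d : A ⟶ M} {l : B ⟶ M}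
    {η : Cell J d l .nil} (H : FactorsTo s .all η) : FactorsTo s .nullary η :=
  fun _ _ P L h hP _ => H P L h hP trivial

theorem postcomp_id {A B M : 𝒦} {J : HPath Hor A B} {d : A ⟶ M} {l : B ⟶ M}
    (η : Cell J d l .nil) : HEq (postcomp η (𝟙 M)) η := by
  have h : ∀ {a : A ⟶ M} {b : B ⟶ M} (ha : a = d) (hb : b = l) (ha' : a = d ≫ 𝟙 M)
      (hb' : b = l ≫ 𝟙 M), HEq (vcomp (.single η) (idVer (𝟙 M)) ha' hb') η := by
    intro a b ha hb ha' hb'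
    subst ha hb
    exact heq_of_eq (vcomp_idCell η)
  exact h (Category.comp_id d) (Category.comp_id l) rfl rfl

theorem vcomp_idVer_vcomp {A B C D M N : 𝒦} {J : HPath Hor A B} {K : HPath Hor C D} {f : A ⟶ C}
    {g : B ⟶ D} {d : C ⟶ M} {l : D ⟶ M} (Φ : CellPath J f g K) (η : Cell K d l .nil) (p : M ⟶ N)
    {a a' : A ⟶ N} {b b' : B ⟶ N} {c : A ⟶ M} {e : B ⟶ M} {i : C ⟶ N} {j : D ⟶ N}
    (ha : a = c ≫ p) (hb : b = e ≫ p) (hc : c = f ≫ d) (he : e = g ≫ l)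
    (hi : i = d ≫ p) (hj : j = l ≫ p) (ha' : a' = f ≫ i) (hb' : b' = g ≫ j) :
    HEq (vcomp (.single (vcomp Φ η hc he)) (idVer p) ha hb)
      (vcomp Φ (vcomp (.single η) (idVer p) hi hj) ha' hb') := by
  obtain rfl : a = a' := by rw [ha, ha', hc, hi, Category.assoc]
  obtain rfl : b = b' := by rw [hb, hb', he, hj, Category.assoc]
  exact heq_of_eq (vcomp_single_assoc _ _ _ _ _ _ _ _ _ _ _)

theorem postcomp_postcomp {A B M N N' : 𝒦} {J : HPath Hor A B} {d : A ⟶ M} {l : B ⟶ M}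
    (η : Cell J d l .nil) (f : M ⟶ N) (g : N ⟶ N') :
    HEq (postcomp (postcomp η f) g) (postcomp η (f ≫ g)) := by
  have h := vcomp_idVer_vcomp (.single η) (idVer f) g rfl rfl rfl rfl rfl rfl rfl rfl
  rw [vcomp_single_idVer, eq_of_heq (vcomp_nil_idVer f g rfl rfl)] at h
  exact h

/-- The case `f = 𝟙 M` already contains that `η` itself is left Kan. -/
theorem isAbsolutelyLeftKan_iff {s : Variant} {A B M : 𝒦} {J : HPath Hor A B} {d : A ⟶ M}
    {l : B ⟶ M} {η : Cell J d l .nil} :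
    IsAbsolutelyLeftKan s η ↔ ∀ ⦃N : 𝒦⦄ (f : M ⟶ N), FactorsTo s .nullary (postcomp η f) :=
  ⟨fun H _ f => isLeftKan_iff.1 (H.2 f), fun H =>
    ⟨isLeftKan_iff.2 ((factorsTo_congr (Category.comp_id d) (Category.comp_id l)
      (postcomp_id η)).1 (H (𝟙 M))), fun _ f => isLeftKan_iff.2 (H f)⟩⟩

/-- Factorisation with target `L` through `η` amounts to factorisation with target `K` through
`p ∘ η`, for any cartesian cell `L ⇒ K` with vertical source `p`. -/
theorem IsCartesian.factorsAt_iff {A B M B' D E F : 𝒦} {J : HPath Hor A B} {d : A ⟶ M}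
    {l : B ⟶ M} (η : Cell J d l .nil) {L : Hor M D} {p : M ⟶ E} {q : D ⟶ F}
    {K : ShortPath Hor E F} {ψ : Cell (.single L) p q K} (hψ : IsCartesian ψ)
    (H : HPath Hor B B') (h : B' ⟶ D) {k : B' ⟶ F} (hk : k = h ≫ q) :
    FactorsAt η H (.single L) h ↔ FactorsAt (postcomp η p) H K k := by
  -- A commuting square: composition with `ψ` gives two bijective sides, so the two factorisation
  -- maps are bijective together.
  have key : (fun φ : Cell (J.comp H) d h (.single L) => vcomp (.single φ) ψ rfl hk) ∘
      (fun φ : Cell H l h (.single L) => hcomp η φ) =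
      (fun φ : Cell H (l ≫ p) k K => hcomp (postcomp η p) φ) ∘
      (fun φ : Cell H l h (.single L) => vcomp (.single φ) ψ rfl hk) :=
    funext fun φ => hcomp_vcomp η φ ψ rfl rfl hk
  unfold FactorsAt
  rw [← (hψ.bijective (J.comp H) d h rfl hk).of_comp_iff' _, key,
    (hψ.bijective H l h rfl hk).of_comp_iff]

/-- Each horizontal `L` out of `M` has a cartesian nullary cell with vertical source `y`, which
trades the target `L` for an empty one at the cost of replacing `η` by `y ∘ η`. -/
theorem FactorsTo.all_of_yoneda {s : Variant} {A B M M' : 𝒦} {J : HPath Hor A B} {d : A ⟶ M}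
    {l : B ⟶ M} {η : Cell J d l .nil} {y : M ⟶ M'} (hy : IsYoneda s y)
    (h₁ : FactorsTo s .nullary η) (h₂ : FactorsTo s .nullary (postcomp η y)) :
    FactorsTo s .all η := by
  intro B' K H L h hH _
  cases L with
  | nil => exact h₁ H .nil h hH trivial
  | single L =>
    obtain ⟨j, ψ, hψ⟩ := hy.2 L
    exact (hψ.factorsAt_iff η H h rfl).2 (h₂ H .nil _ hH trivial)

/-- The cartesian cell of the companion has trivial vertical target, so nullary cells through `g ∘
η` with any vertical target `h` correspond to cells into `g_*` through `η`. -/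
theorem FactorsTo.postcomp_of_hasCompanion {s : Variant} {A B M N : 𝒦} {J : HPath Hor A B}
    {d : A ⟶ M} {l : B ⟶ M} {η : Cell J d l .nil} (H : FactorsTo s .all η) {g : M ⟶ N}
    (hg : HasCompanion g) : FactorsTo s .nullary (postcomp η g) := by
  obtain ⟨S, c, hc⟩ := hg
  intro B' K P L h hP hL
  cases L with
  | nil => exact (hc.factorsAt_iff η P h (Category.comp_id h).symm).1 (H P _ h hP trivial)
  | single L => exact hL.elim

theorem factorsTo_all_of_nullary {s : Variant} (hK : HasCartesianNullaryCells 𝒦) {A B M : 𝒦}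
    {J : HPath Hor A B} {d : A ⟶ M} {l : B ⟶ M} {η : Cell J d l .nil}
    (H : ∀ ⦃N : 𝒦⦄ (f : M ⟶ N), FactorsTo s .nullary (postcomp η f)) ⦃N : 𝒦⦄ (f : M ⟶ N) :
    FactorsTo s .all (postcomp η f) := by
  intro B' K P L h hP _
  cases L with
  | nil => exact H f P .nil h hP trivial
  | single L =>
    obtain ⟨C, p, q, ψ, hψ⟩ := hK L
    exact (hψ.factorsAt_iff _ P h rfl).2
      ((factorsTo_congr (by simp) (by simp) (postcomp_postcomp η f p)).2 (H (f ≫ p)) P .nil _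
        hP trivial)

/-! ### Cocartesian cells and factorisations -/

theorem isWeaklyCocartesian_congr {r : Targets} {A B C D : 𝒦} {J J' : HPath Hor A B} {f : A ⟶ C}
    {g : B ⟶ D} {K K' : HPath Hor C D} {Φ : CellPath J f g K} {Φ' : CellPath J' f g K'}
    (hJ : J = J') (hK : K = K') (hΦ : HEq Φ Φ') :
    IsWeaklyCocartesian r Φ ↔ IsWeaklyCocartesian r Φ' := by
  subst hJ hK hΦ
  rfl

theorem isWeaklyCocartesian_iff {r : Targets} {A B C : 𝒦} {J : HPath Hor A B} {f : A ⟶ C}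
    {K : HPath Hor C B} {Φ : CellPath J f (𝟙 B) K} :
    IsWeaklyCocartesian r Φ ↔ ∀ ⦃E F : 𝒦⦄ (L : ShortPath Hor E F) (h : C ⟶ E) (k : B ⟶ F),
      r.Allows L → Function.Bijective
        (fun χ : Cell K h k L => vcomp Φ χ rfl (Category.id_comp k).symm) := by
  have key : ∀ {E F : 𝒦} (L : ShortPath Hor E F) (h : C ⟶ E) (k k' : B ⟶ F) (e : k' = 𝟙 B ≫ k),
      (∀ χ : Cell J (f ≫ h) k' L, ∃! χ' : Cell K h k L, vcomp Φ χ' rfl e = χ) ↔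
      Function.Bijective
        (fun χ : Cell K h k L => vcomp Φ χ rfl (Category.id_comp k).symm) := by
    intro E F L h k k' e
    obtain rfl : k' = k := e.trans (Category.id_comp k)
    exact (Function.bijective_iff_existsUnique _).symm
  exact ⟨fun H E F L h k hL => (key L h k _ rfl).1 fun χ => H L h k χ hL,
    fun H E F L h k χ hL => (key L h k _ rfl).2 (H L h k hL) χ⟩

section Conjoint

variable {A B M : 𝒦} {J : HPath Hor A B} {d : A ⟶ M} {l : B ⟶ M} {η : Cell J d l .nil}
  {S : Hor M B} {cart : Cell (.single S) (𝟙 M) l .nil} {η' : Cell J d (𝟙 B) (.single S)}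

/-- Interchange gives `((f ∘ cart) ⊙ φ) ∘ (η' ⌢ Γ) = (f ∘ η) ⊙ (φ ∘ Γ)`, a square in which the
conjoint and `Γ` provide two bijective sides. -/
theorem isWeaklyCocartesian_append_iff (hcart : IsCartesian cart)
    (hη : vcomp (.single η') cart (Category.comp_id d).symm (Category.id_comp l).symm = η)
    (r : Targets) {B' : 𝒦} {H H' : HPath Hor B B'} {Γ : CellPath H (𝟙 B) (𝟙 B') H'}
    (hΓ : PrecompBijective Γ) :
    IsWeaklyCocartesian r ((CellPath.single η').append Γ) ↔
      ∀ ⦃N K : 𝒦⦄ (L : ShortPath Hor N K) (f : M ⟶ N) (h : B' ⟶ K), r.Allows L →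
        FactorsAt (postcomp η f) H L h := by
  rw [isWeaklyCocartesian_iff]
  refine forall₅_congr fun N K L f h => imp_congr_right fun _ => ?_
  have key : (fun χ : Cell ((HPath.single S).comp H') f h L =>
        vcomp ((CellPath.single η').append Γ) χ rfl (Category.id_comp h).symm) ∘
      (fun φ : Cell H' (l ≫ f) h L => hcomp (postcompConjoint cart f) φ) =
      (fun φ : Cell H (l ≫ f) h L => hcomp (postcomp η f) φ) ∘
      (fun φ : Cell H' (l ≫ f) h L => vcomp Γ φ (Category.id_comp _).symm
        (Category.id_comp _).symm) := by
    funext φ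
    refine (vcomp_hcomp (.single η') Γ (postcompConjoint cart f) φ rfl
      (Category.id_comp _).symm _).trans ?_
    have h1 := vcomp_idVer_vcomp (.single η') cart f rfl rfl (Category.comp_id d).symm
      (Category.id_comp l).symm (Category.id_comp f).symm rfl rfl (Category.id_comp _).symm
    rw [hη] at h1
    exact congrArg (fun ζ => hcomp ζ _) (eq_of_heq h1).symm
  unfold FactorsAt
  rw [← (hΓ (l ≫ f) h L).of_comp_iff, ← key]
  exact ((hcart.hcomp_bijective f H' h L).of_comp_iff _).symm

/-- `η'` is right (respectively weakly) cocartesian precisely if all `f ∘ η` satisfy the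
factorisation property. -/
theorem isCocartesian_iff (hcart : IsCartesian cart)
    (hη : vcomp (.single η') cart (Category.comp_id d).symm (Category.id_comp l).symm = η)
    (s : Variant) (r : Targets) :
    IsCocartesian s r η' ↔ ∀ ⦃N : 𝒦⦄ (f : M ⟶ N), FactorsTo s r (postcomp η f) := by
  have hnil := isWeaklyCocartesian_append_iff hcart hη r (precompBijective_nil B)
  cases s with
  | weak =>
    refine hnil.trans ⟨fun H N f B' K P L h hP hL => ?_, fun H N K L f h hL =>
      H f .nil L h trivial hL⟩
    cases P with
    | nil => exact H L f h hL
    | cons P I => exact hP.elim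
  | ordinary =>
    have happ : ∀ {Y B' : 𝒦} {K₁ : Hor B Y} {R : Hor B Y}
        {c : Cell (.single R) (𝟙 B) (𝟙 Y) (.single K₁)} (T : HPath Hor Y B'), IsCartesian c →
        (IsWeaklyCocartesian r (CellPath.append (.snoc (.single η') c rfl rfl) (idPath T)) ↔
          ∀ ⦃N K : 𝒦⦄ (L : ShortPath Hor N K) (f : M ⟶ N) (h : B' ⟶ K), r.Allows L →
            FactorsAt (postcomp η f) ((HPath.single R).comp T) L h) := fun {Y B' K₁ R c} T hc =>
      (isWeaklyCocartesian_congr (HPath.comp_assoc _ _ _) (HPath.comp_assoc _ _ _)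
        (CellPath.append_assoc (.single η') (.single c) (idPath T))).trans
        (isWeaklyCocartesian_append_iff hcart hη r (hc.precompBijective T))
    constructor
    · rintro ⟨H₁, H₂⟩ N f B' K P
      refine HPath.front_cases (motive := fun {B'} P => ∀ {K : 𝒦} (L : ShortPath Hor N K)
        (h : B' ⟶ K), Variant.Allows .ordinary P → r.Allows L → FactorsAt (postcomp η f) P L h)
        ?_ ?_ P
      · exact fun L h _ hL => hnil.1 H₁ L f h hL
      -- A non-empty path `K₁ ⌢ T` is reached by choosing `id_{K₁}` as the cartesian cell.
      · exact fun K₁ T K L h _ hL =>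
          (happ T (isCartesian_idHor K₁)).1 (H₂ K₁ K₁ _ T (isCartesian_idHor K₁)) L f h hL
    · intro H
      exact ⟨hnil.2 fun N K L f h hL => H f .nil L h trivial hL, fun Y B' K₁ R c T hc =>
        (happ T hc).2 fun N K L f h hL => H f _ L h trivial hL⟩

end Conjoint

theorem leftBeckChevalley_iff {s : Variant} {A B M : 𝒦} {J : HPath Hor A B} {d : A ⟶ M}
    {l : B ⟶ M} {η : Cell J d l .nil} (hl : HasConjoint l) :
    LeftBeckChevalley s η ↔ IsAbsolutelyLeftKan s η := by
  rw [isAbsolutelyLeftKan_iff]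
  constructor
  · rintro ⟨S, c, φ, hc, h, hφ⟩
    exact (isCocartesian_iff hc h s .nullary).1 hφ
  · intro H
    obtain ⟨S, c, hc⟩ := hl
    obtain ⟨φ, h, -⟩ := hc.existsUnique η (Category.comp_id d).symm (Category.id_comp l).symm
    exact ⟨S, c, φ, hc, h, (isCocartesian_iff hc h s .nullary).2 H⟩

/-! ### Pointwise variants -/

section Pointwise

variable {A A' B : 𝒦} {P : HPath Hor A A'} {J : Hor A' B}

theorem precompLast_idHor {M : 𝒦} {d : A ⟶ M} {l : B ⟶ M} (η : Cell (P.cons J) d l .nil) :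
    HEq (precompLast η (idHor J) rfl) η := by
  have h : ∀ {b : B ⟶ M} (hb : b = l) (hb' : b = 𝟙 B ≫ l),
      HEq (precompLast η (idHor J) hb') η := by
    intro b hb hb'
    subst hb
    exact heq_of_eq (idPath_vcomp η)
  exact h (Category.id_comp l) rfl

theorem postcomp_precompLast {M N Y : 𝒦} {d : A ⟶ M} {l : B ⟶ M} (η : Cell (P.cons J) d l .nil)
    (f : M ⟶ N) {k : Y ⟶ B} {R : Hor A' Y} (c : Cell (.single R) (𝟙 A') k (.single J)) :
    HEq (postcomp (precompLast η c rfl) f) (precompLast (postcomp η f) c rfl) :=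
  vcomp_idVer_vcomp _ _ _ _ _ _ _ _ _ _ _

/-- `η ∘ (id, …, id, cart)` has the unique factorisation property, for any restriction. -/
def PointwiseFactorsTo (s : Variant) (r : Targets) {M : 𝒦} {d : A ⟶ M} {l : B ⟶ M}
    (η : Cell (P.cons J) d l .nil) : Prop :=
  ∀ ⦃Y : 𝒦⦄ (k : Y ⟶ B) (R : Hor A' Y) (c : Cell (.single R) (𝟙 A') k (.single J)),
    IsCartesian c → FactorsTo s r (precompLast η c rfl)

variable {M : 𝒦} {d : A ⟶ M} {l : B ⟶ M} {η : Cell (P.cons J) d l .nil}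

theorem isPointwiseLeftKan_iff {s : Variant} :
    IsPointwiseLeftKan s η ↔ PointwiseFactorsTo s .nullary η :=
  ⟨fun H _ k R c hc => isLeftKan_iff.1 (H.2 k R c hc), fun H =>
    ⟨isLeftKan_iff.2 ((factorsTo_congr rfl (Category.id_comp l) (precompLast_idHor η)).1
      (H _ J _ (isCartesian_idHor J))), fun _ k R c hc => isLeftKan_iff.2 (H k R c hc)⟩⟩

theorem pointwiseFactorsTo_postcomp_iff {s : Variant} {r : Targets} {N : 𝒦} (f : M ⟶ N) :
    PointwiseFactorsTo s r (postcomp η f) ↔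
      ∀ ⦃Y : 𝒦⦄ (k : Y ⟶ B) (R : Hor A' Y) (c : Cell (.single R) (𝟙 A') k (.single J)),
        IsCartesian c → FactorsTo s r (postcomp (precompLast η c rfl) f) :=
  forall₅_congr fun _ _ _ c _ =>
    (factorsTo_congr rfl (Category.assoc _ _ _) (postcomp_precompLast η f c)).symm

/-- Composing with `f` commutes with restricting along `cart`, so the two quantifiers can be
exchanged. -/
theorem isAbsolutelyPointwiseLeftKan_iff {s : Variant} :
    IsAbsolutelyPointwiseLeftKan s η ↔
      ∀ ⦃Y : 𝒦⦄ (k : Y ⟶ B) (R : Hor A' Y) (c : Cell (.single R) (𝟙 A') k (.single J)),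
        IsCartesian c → IsAbsolutelyLeftKan s (precompLast η c rfl) := by
  simp only [IsAbsolutelyPointwiseLeftKan, isPointwiseLeftKan_iff, pointwiseFactorsTo_postcomp_iff]
  constructor
  · exact fun H Y k R c hc => isAbsolutelyLeftKan_iff.2 fun N f => H.2 f k R c hc
  · exact fun H => ⟨fun Y k R c hc => isLeftKan_iff.1 (H k R c hc).1,
      fun N f Y k R c hc => isLeftKan_iff.1 ((H k R c hc).2 f)⟩

theorem factorsTo_postcomp_precompLast_idHor_iff {s : Variant} {r : Targets} :
    (∀ ⦃N : 𝒦⦄ (f : M ⟶ N), FactorsTo s r (postcomp (precompLast η (idHor J) rfl) f)) ↔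
      ∀ ⦃N : 𝒦⦄ (f : M ⟶ N), FactorsTo s r (postcomp η f) := by
  have h : ∀ {l' : B ⟶ M} {ζ : Cell (P.cons J) d l' .nil}, l' = l → HEq ζ η →
      ((∀ ⦃N : 𝒦⦄ (f : M ⟶ N), FactorsTo s r (postcomp ζ f)) ↔
        ∀ ⦃N : 𝒦⦄ (f : M ⟶ N), FactorsTo s r (postcomp η f)) := by
    rintro _ _ rfl ⟨⟩
    rfl
  exact h (Category.id_comp l) (precompLast_idHor η)

/-- If all conjoints of the `l ∘ k` exist then `η'` is pointwise cocartesian precisely if the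
`f ∘ η ∘ (id, …, id, cart)` satisfy the factorisation property. -/
theorem isPointwiseCocartesian_iff (hl : ∀ {X : 𝒦} (k : X ⟶ B), HasConjoint (k ≫ l))
    {S : Hor M B} {cart : Cell (.single S) (𝟙 M) l .nil}
    {η' : Cell (P.cons J) d (𝟙 B) (.single S)} (hcart : IsCartesian cart)
    (hη : vcomp (.single η') cart (Category.comp_id d).symm (Category.id_comp l).symm = η)
    (s : Variant) (r : Targets) :
    IsPointwiseCocartesian s r η' ↔
      ∀ ⦃Y : 𝒦⦄ (k : Y ⟶ B) (R : Hor A' Y) (c : Cell (.single R) (𝟙 A') k (.single J)),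
        IsCartesian c → ∀ ⦃N : 𝒦⦄ (f : M ⟶ N),
          FactorsTo s r (postcomp (precompLast η c rfl) f) := by
  -- A factorisation of the restricted `η'` through `c'` is also the factorisation of the restricted
  -- `η` through `cart ∘ c'`, the candidate cartesian cell for the conjoint of `k ≫ l`.
  have key : ∀ {Y : 𝒦} {k : Y ⟶ B} {R : Hor A' Y} {c : Cell (.single R) (𝟙 A') k (.single J)}
      {S' : Hor M Y} {c' : Cell (.single S') (𝟙 M) k (.single S)}
      {φ : Cell (P.cons R) d (𝟙 Y) (.single S')},
      vcomp (.single φ) c' (Category.comp_id d).symm (Category.id_comp k).symm =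
        precompLast η' c (Category.comp_id k).symm →
      vcomp (.single φ) (vcomp (.single c') cart (Category.comp_id _).symm rfl)
        (Category.comp_id d).symm (Category.id_comp _).symm = precompLast η c rfl := by
    intro Y k R c S' c' φ hφ
    have h1 := vcomp_single_assoc (.single φ) c' (Category.comp_id d).symm
      (Category.id_comp k).symm cart (Category.comp_id d).symm rfl (Category.comp_id _).symm rfl
      (Category.comp_id d).symm (Category.id_comp _).symm
    refine h1.symm.trans ?_
    rw [hφ, ← hη]
    exact vcomp_single_assoc _ _ _ _ _ _ _ _ _ _ _
  constructor
  · rintro ⟨-, H⟩ Y k R c hc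
    obtain ⟨S', c', φ, hc', hφ, hcoc⟩ := H k R c hc
    exact (isCocartesian_iff ((hcart.vcomp_iff _ _).2 hc') (key hφ) s r).1 hcoc
  · intro H
    refine ⟨(isCocartesian_iff hcart hη s r).2
      (factorsTo_postcomp_precompLast_idHor_iff.1 (H _ J _ (isCartesian_idHor J))), ?_⟩
    intro Y k R c hc
    obtain ⟨S', cart', hcart'⟩ := hl k
    -- The conjoint of `k ≫ l` factors through that of `l`; by pasting, the factor defines the
    -- required restriction `S(id, k)`.
    obtain ⟨c', rfl, -⟩ := hcart.existsUnique (h := 𝟙 M) (k := k) cart' (Category.comp_id _).symm rfl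
    have hc' := (hcart.vcomp_iff _ _).1 hcart'
    obtain ⟨φ, hφ, -⟩ := hc'.existsUnique (precompLast η' c (Category.comp_id k).symm)
      (Category.comp_id d).symm (Category.id_comp k).symm
    exact ⟨S', c', φ, hc', hφ, (isCocartesian_iff hcart' (key hφ) s r).2 (H k R c hc)⟩

theorem pointwiseLeftBeckChevalley_iff {s : Variant}
    (hl : ∀ {X : 𝒦} (k : X ⟶ B), HasConjoint (k ≫ l)) (hl' : HasConjoint l) :
    PointwiseLeftBeckChevalley s η ↔ IsAbsolutelyPointwiseLeftKan s η := by
  simp only [isAbsolutelyPointwiseLeftKan_iff, isAbsolutelyLeftKan_iff]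
  constructor
  · rintro ⟨S, c, φ, hc, h, hφ⟩
    exact (isPointwiseCocartesian_iff hl hc h s .nullary).1 hφ
  · intro H
    obtain ⟨S, c, hc⟩ := hl'
    obtain ⟨φ, h, -⟩ := hc.existsUnique η (Category.comp_id d).symm (Category.id_comp l).symm
    exact ⟨S, c, φ, hc, h, (isPointwiseCocartesian_iff hl hc h s .nullary).2 H⟩

end Pointwise

end AugmentedVirtualDoubleCategory

/-! ### The implications between the conditions -/

theorem mainTheorem10 {𝒦 : Type u} [AugmentedVirtualDoubleCategory.{u, v, w, t} 𝒦] (s : Variant) :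
    -- the ordinary (respectively weak) conditions
    (∀ {A B M : 𝒦} {J : HPath Hor A B} {d : A ⟶ M} {l : B ⟶ M} (η : Cell J d l .nil),
      -- (a) ⇒ (d)
      (FactorsAfterAll s η → IsAbsolutelyLeftKan s η) ∧
      -- if the conjoint of `l` exists, with `η = cart ∘ η'`
      (∀ (S : Hor M B) (cart : Cell (.single S) (𝟙 M) l .nil)
          (η' : Cell J d (𝟙 B) (.single S)),
        IsCartesian cart → vcomp (.single η') cart (by simp) (by simp) = η →
          (FactorsAfterAll s η ↔ IsCocartesian s .all η') ∧
          (IsCocartesian s .all η' → LeftBeckChevalley s η) ∧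
          (LeftBeckChevalley s η ↔ IsAbsolutelyLeftKan s η) ∧
          (HasCartesianNullaryCells 𝒦 →
            [FactorsAfterAll s η, IsCocartesian s .all η', LeftBeckChevalley s η,
              IsAbsolutelyLeftKan s η].TFAE)) ∧
      -- if a (weak) Yoneda morphism on `M` exists: (d) ⇒ (e) ⇒ (f) ⇒ (g)
      (∀ {M' : 𝒦} (y : M ⟶ M'), IsYoneda s y →
        (IsAbsolutelyLeftKan s η → IsLeftKan s η ∧ IsLeftKan s (postcomp η y)) ∧
        (IsLeftKan s η ∧ IsLeftKan s (postcomp η y) → Factors s η) ∧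
        (Factors s η → IsLeftKan s η ∧
          ∀ ⦃N : 𝒦⦄ (g : M ⟶ N), HasCompanion g → IsLeftKan s (postcomp η g))) ∧
      -- (g) ⇒ (d)
      (HasCompanions 𝒦 →
        (IsLeftKan s η ∧
          ∀ ⦃N : 𝒦⦄ (g : M ⟶ N), HasCompanion g → IsLeftKan s (postcomp η g)) →
        IsAbsolutelyLeftKan s η)) ∧
    -- the pointwise (respectively pointwise weak) conditions
    (∀ {A A' B M : 𝒦} {P : HPath Hor A A'} {J : Hor A' B} {d : A ⟶ M} {l : B ⟶ M}
        (η : Cell (P.cons J) d l .nil),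
      (∀ {X : 𝒦} (k : X ⟶ B), HasConjoint (k ≫ l)) →
      (PointwiseFactorsAfterAll s η → IsAbsolutelyPointwiseLeftKan s η) ∧
      (∀ (S : Hor M B) (cart : Cell (.single S) (𝟙 M) l .nil)
          (η' : Cell (P.cons J) d (𝟙 B) (.single S)),
        IsCartesian cart → vcomp (.single η') cart (by simp) (by simp) = η →
          (PointwiseFactorsAfterAll s η ↔ IsPointwiseCocartesian s .all η') ∧
          (IsPointwiseCocartesian s .all η' → PointwiseLeftBeckChevalley s η) ∧
          (PointwiseLeftBeckChevalley s η ↔ IsAbsolutelyPointwiseLeftKan s η) ∧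
          (HasCartesianNullaryCells 𝒦 →
            [PointwiseFactorsAfterAll s η, IsPointwiseCocartesian s .all η',
              PointwiseLeftBeckChevalley s η, IsAbsolutelyPointwiseLeftKan s η].TFAE)) ∧
      (∀ {M' : 𝒦} (y : M ⟶ M'), IsYoneda s y →
        (IsAbsolutelyPointwiseLeftKan s η →
          IsPointwiseLeftKan s η ∧ IsPointwiseLeftKan s (postcomp η y)) ∧
        (IsPointwiseLeftKan s η ∧ IsPointwiseLeftKan s (postcomp η y) → PointwiseFactors s η) ∧
        (PointwiseFactors s η → IsPointwiseLeftKan s η ∧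
          ∀ ⦃N : 𝒦⦄ (g : M ⟶ N), HasCompanion g → IsPointwiseLeftKan s (postcomp η g))) ∧
      (HasCompanions 𝒦 →
        (IsPointwiseLeftKan s η ∧
          ∀ ⦃N : 𝒦⦄ (g : M ⟶ N), HasCompanion g → IsPointwiseLeftKan s (postcomp η g)) →
        IsAbsolutelyPointwiseLeftKan s η)) := by
  refine ⟨fun {A B M J d l} η => ⟨?_, ?_, ?_, ?_⟩, fun {A A' B M P J d l} η hl => ⟨?_, ?_, ?_, ?_⟩⟩
  · rw [factorsAfterAll_iff, isAbsolutelyLeftKan_iff]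
    exact fun H N f => (H f).nullary
  · intro S cart η' hcart hη
    have hab : FactorsAfterAll s η ↔ IsCocartesian s .all η' :=
      factorsAfterAll_iff.trans (isCocartesian_iff hcart hη s .all).symm
    have hbc : IsCocartesian s .all η' → LeftBeckChevalley s η := fun H =>
      ⟨S, cart, η', hcart, hη, (isCocartesian_iff hcart hη s .nullary).2 fun N f =>
        ((isCocartesian_iff hcart hη s .all).1 H f).nullary⟩
    have hcd : LeftBeckChevalley s η ↔ IsAbsolutelyLeftKan s η :=
      leftBeckChevalley_iff ⟨S, cart, hcart⟩
    refine ⟨hab, hbc, hcd, fun hK => ?_⟩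
    tfae_have 1 ↔ 2 := hab
    tfae_have 2 → 3 := hbc
    tfae_have 3 ↔ 4 := hcd
    tfae_have 4 → 1 := fun H =>
      factorsAfterAll_iff.2 (factorsTo_all_of_nullary hK (isAbsolutelyLeftKan_iff.1 H))
    tfae_finish
  · intro M' y hy
    simp only [isLeftKan_iff, factors_iff]
    exact ⟨fun H => ⟨isLeftKan_iff.1 H.1, isLeftKan_iff.1 (H.2 y)⟩,
      fun H => FactorsTo.all_of_yoneda hy H.1 H.2,
      fun H => ⟨H.nullary, fun N g hg => H.postcomp_of_hasCompanion hg⟩⟩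
  · exact fun hK H => ⟨H.1, fun N f => H.2 f (hK f)⟩
  · rw [isAbsolutelyPointwiseLeftKan_iff]
    exact fun H Y k R c hc => isAbsolutelyLeftKan_iff.2 fun N f =>
      (factorsAfterAll_iff.1 (H k R c hc) f).nullary
  · intro S cart η' hcart hη
    have hab : PointwiseFactorsAfterAll s η ↔ IsPointwiseCocartesian s .all η' := by
      rw [isPointwiseCocartesian_iff hl hcart hη s .all]
      simp only [PointwiseFactorsAfterAll, factorsAfterAll_iff]
    have hbc : IsPointwiseCocartesian s .all η' → PointwiseLeftBeckChevalley s η := fun H =>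
      ⟨S, cart, η', hcart, hη, (isPointwiseCocartesian_iff hl hcart hη s .nullary).2
        fun Y k R c hc N f =>
          ((isPointwiseCocartesian_iff hl hcart hη s .all).1 H k R c hc f).nullary⟩
    have hcd : PointwiseLeftBeckChevalley s η ↔ IsAbsolutelyPointwiseLeftKan s η :=
      pointwiseLeftBeckChevalley_iff hl ⟨S, cart, hcart⟩
    refine ⟨hab, hbc, hcd, fun hK => ?_⟩
    tfae_have 1 ↔ 2 := hab
    tfae_have 2 → 3 := hbc
    tfae_have 3 ↔ 4 := hcd
    tfae_have 4 → 1 := fun H Y k R c hc => factorsAfterAll_iff.2 (factorsTo_all_of_nullary hK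
      (isAbsolutelyLeftKan_iff.1 (isAbsolutelyPointwiseLeftKan_iff.1 H k R c hc)))
    tfae_finish
  · intro M' y hy
    refine ⟨fun H => ⟨H.1, H.2 y⟩, fun H Y k R c hc => ?_, fun H => ⟨?_, fun N g hg => ?_⟩⟩
    · exact factors_iff.2 (FactorsTo.all_of_yoneda hy (isPointwiseLeftKan_iff.1 H.1 k R c hc)
        ((pointwiseFactorsTo_postcomp_iff y).1 (isPointwiseLeftKan_iff.1 H.2) k R c hc))
    · exact isPointwiseLeftKan_iff.2 fun Y k R c hc => (factors_iff.1 (H k R c hc)).nullary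
    · exact isPointwiseLeftKan_iff.2 ((pointwiseFactorsTo_postcomp_iff g).2 fun Y k R c hc =>
        (factors_iff.1 (H k R c hc)).postcomp_of_hasCompanion hg)
  · exact fun hK H => ⟨H.1, fun N f => H.2 f (hK f)⟩
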